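/- Let $q$ be a prime power and let $\mathrm{PG}(2,q)$ be the projective plane over the field with $q$ elements. A double blocking set is a set of points that meets every line in at least two points, and a triangle is the union of three non-concurrent lines (it is a double blocking set of size $3q$). Then there is no double blocking set of size $3q-1$ in $\mathrm{PG}(2,q)$ that can be obtained by removing six points of a triangle and adding five new points, that is, five points not lying on the triangle. -/

import Mathlib

open scoped LinearAlgebra.Projectivization

/-- The set of points of the projective plane `PG(2,q)` over a field `K` with `q` elements: the
one-dimensional subspaces of `K³`. -/
abbrev PG2 (K : Type*) [Field K] : Type _ := ℙ K (Fin 3 → K)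

/-- The line of `PG(2,q)` with homogeneous (dual) coordinates `l = [a : b : c]`, as a set of
points: all `(x : y : z)` with `a x + b y + c z = 0`. -/
def PG2.line {K : Type*} [Field K] (l : PG2 K) : Set (PG2 K) :=
  {P | Projectivization.orthogonal P l}

/-- A `t`-fold blocking set: a set of points meeting every line in at least `t` points. -/
def IsBlockingSet {K : Type*} [Field K] (t : ℕ) (B : Set (PG2 K)) : Prop :=
  ∀ l : PG2 K, t ≤ (B ∩ PG2.line l).ncard

/-- A double blocking set is a `2`-fold blocking set. -/
def IsDoubleBlockingSet {K : Type*} [Field K] (B : Set (PG2 K)) : Prop :=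
  IsBlockingSet 2 B

/-- A triangle: the union of three non-concurrent lines. (Three lines with no common point are
automatically pairwise distinct, since any two lines of the plane meet.) -/
def IsTriangle {K : Type*} [Field K] (T : Set (PG2 K)) : Prop :=
  ∃ l m n : PG2 K, PG2.line l ∩ PG2.line m ∩ PG2.line n = ∅ ∧
    T = PG2.line l ∪ PG2.line m ∪ PG2.line n

/-- `B` is obtained from the point set `T` by removing `x` of the points of `T` and adding `y` new
points, that is, points not in `T`. -/
def IsObtainedBy {K : Type*} [Field K] (x y : ℕ) (T B : Set (PG2 K)) : Prop :=
  ∃ R N : Set (PG2 K), R ⊆ T ∧ R.ncard = x ∧ Disjoint N T ∧ N.ncard = y ∧ B = (T \ R) ∪ N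

/-! Choose coordinates in which the triangle is xyz = 0. The points of the sides other than vertices
are (0,1,-α), (-β,0,1), (1,-γ,0) with nonzero parameters, collinear exactly when αβγ = 1. Projecting
a new point from the three vertices onto the opposite sides gives parameters a, b, c with abc = -1.
The blocking condition becomes a set of inequalities on the sets A, B, C of removed parameters, the
removed vertices, and the five triples (a, b, c): this is `TriangleConfig`, produced by
`exists_triangleConfig`.

If no vertex is removed, two counts fix the shape. Combinatorial Nullstellensatz (`not_grid_cover`)
gives |A| + |B| ≤ 5, and cyclically, so no side is untouched; the pencil of lines through a removed
point then gives |B| + |C| ≤ 4, and cyclically. Hence two points are removed from each side and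
every pencil is tight. Tightness gives equality of sums and of sums of inverses: two of the a's are
the removed parameters, and the other three have vanishing first and second elementary symmetric
functions, so they have a common cube. Call a new point special for a side if its projection there
is a removed point, and ordinary if it is special for none. Comparing cubes leaves three patterns:
one doubly and four simply special points (`not_spread`), two triply special points (`not_doubled`),
or three doubly special points (`not_cyclic`). Incidence and cube relations exclude each.

If a vertex is removed, the lines through it force q ≤ 6, and the need to retain two points on each
side leaves q = 4 or q = 5. For q = 4 a double count of the complement excludes every double
blocking set of 11 points. For q = 5 there are separate arguments for one, two and three removed
vertices. -/

section
variable {K : Type*} [Field K]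

/-! ### Incidence in triangle coordinates -/

/-- Incidence of the new point with parameters `a`, `b` and the line joining the points with
parameters `α`, `β` on two sides of the triangle. -/
def OnJoin (a b α β : K) : Prop := α * β + a * b = a * β

/-- A line with αβγ = 1 cuts the sides at α, β, γ, so incidence can be tested on any two sides. This
cyclic symmetry lets later arguments treat one side only. -/
lemma OnJoin.rotate {a b c α β γ : K} (h : a * b * c = -1) (hl : α * β * γ = 1)
    (ho : OnJoin a b α β) : OnJoin b c β γ := by
  unfold OnJoin at *
  have ha : a ≠ 0 := by rintro rfl; simp at h
  have hα : α ≠ 0 := by rintro rfl; simp at hl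
  have hβ : β ≠ 0 := by rintro rfl; simp at hl
  have : a * α * β * (β * γ + b * c - b * γ) = 0 := by
    linear_combination (a * β - a * b) * hl + α * β * h - ho
  have h2 := (mul_eq_zero.1 this).resolve_left (by simp [ha, hα, hβ])
  linear_combination h2

lemma onJoin_rotate_iff {a b c α β γ : K} (h : a * b * c = -1) (hl : α * β * γ = 1) :
    OnJoin a b α β ↔ OnJoin b c β γ :=
  ⟨OnJoin.rotate h hl, fun ho => OnJoin.rotate (a := c) (α := γ) (by linear_combination h)
    (by linear_combination hl) (OnJoin.rotate (by linear_combination h) (by linear_combination hl) ho)⟩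

/-- Lines through the side point α are labelled by β⁻¹, and a new point lies on the one labelled b⁻¹
+ αc. Label 0 is the line to the opposite vertex. The label is affine in α. -/
lemma onJoin_iff_inv {a b c α β : K} (h : a * b * c = -1) (hβ : β ≠ 0) :
    OnJoin a b α β ↔ b⁻¹ + α * c = β⁻¹ := by
  unfold OnJoin
  have ha : a ≠ 0 := by rintro rfl; simp at h
  have hb : b ≠ 0 := by rintro rfl; simp at h
  have hc : c = -(a * b)⁻¹ := by
    field_simp
    linear_combination h
  subst hc
  field_simp
  constructor
  · intro h; linear_combination -h
  · intro h; linear_combination -h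

/-! ### The numerical configuration and pencils of lines -/

open Classical in
/-- The combinatorial data of a set obtained from a triangle by removing the side points with
parameters in `A`, `B`, `C` and `u`, `v`, `w` copies of the vertices, and adding the five points
with parameters `a`, `b`, `c`. -/
structure TriangleConfig (A B C : Finset K) (u v w : ℕ) (a b c : Fin 5 → K) : Prop where
  prod : ∀ i, a i * b i * c i = -1
  inj : ∀ i j, a i = a j → b i = b j → i = j
  zeroA : 0 ∉ A
  zeroB : 0 ∉ B
  zeroC : 0 ∉ C
  vertA : ∀ α, α ≠ 0 → (if α ∈ A then 1 else 0) + u ≤ (Finset.univ.filter fun i => a i = α).card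
  vertB : ∀ β, β ≠ 0 → (if β ∈ B then 1 else 0) + v ≤ (Finset.univ.filter fun i => b i = β).card
  vertC : ∀ γ, γ ≠ 0 → (if γ ∈ C then 1 else 0) + w ≤ (Finset.univ.filter fun i => c i = γ).card
  join : ∀ α β γ, α * β * γ = 1 →
    (if α ∈ A then 1 else 0) + (if β ∈ B then 1 else 0) + (if γ ∈ C then 1 else 0) ≤
      1 + (Finset.univ.filter fun i => OnJoin (a i) (b i) α β).card
  total : 6 ≤ A.card + B.card + C.card + u + v + w

namespace TriangleConfig

variable {A B C : Finset K} {u v w : ℕ} {a b c : Fin 5 → K}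

lemma a_ne (h : TriangleConfig A B C u v w a b c) (i : Fin 5) : a i ≠ 0 := by
  intro h0; have := h.prod i; simp [h0] at this
lemma b_ne (h : TriangleConfig A B C u v w a b c) (i : Fin 5) : b i ≠ 0 := by
  intro h0; have := h.prod i; simp [h0] at this
lemma c_ne (h : TriangleConfig A B C u v w a b c) (i : Fin 5) : c i ≠ 0 := by
  intro h0; have := h.prod i; simp [h0] at this

open Classical in
lemma rotate (h : TriangleConfig A B C u v w a b c) : TriangleConfig B C A v w u b c a where
  prod i := by linear_combination h.prod i
  inj i j h1 h2 := h.inj i j (by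
    have e1 := h.prod i
    have e2 := h.prod j
    rw [h1, h2] at e1
    have : b j * c j ≠ 0 := mul_ne_zero (h.b_ne j) (h.c_ne j)
    exact mul_right_cancel₀ this (by linear_combination e1 - e2)) h1
  zeroA := h.zeroB
  zeroB := h.zeroC
  zeroC := h.zeroA
  vertA := h.vertB
  vertB := h.vertC
  vertC := h.vertA
  join α β γ hl := by
    have := h.join γ α β (by linear_combination hl)
    have e : (Finset.univ.filter fun i => OnJoin (a i) (b i) γ α) =
        (Finset.univ.filter fun i => OnJoin (b i) (c i) α β) := by
      ext i
      simp only [Finset.mem_filter, Finset.mem_univ, true_and]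
      exact onJoin_rotate_iff (h.prod i) (by linear_combination hl)
    rw [e] at this
    omega
  total := by have := h.total; omega

-- Each new point lies on exactly one line through the side point α, so the labels of the five new
-- points must contain, with multiplicity, the number required on each line. The vertex line needs 1
-- + u; any other needs one for each further removed point on it.
open Classical in
lemma pencil_le (h : TriangleConfig A B C u v w a b c) {α : K} (hα : α ∈ A) :
    Multiset.replicate (1 + u) 0 + B.val.map (·⁻¹) + C.val.map (α * ·) ≤
      (Finset.univ : Finset (Fin 5)).val.map fun i => (b i)⁻¹ + α * c i := by
  have hα0 : α ≠ 0 := fun e => h.zeroA (e ▸ hα)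
  rw [Multiset.le_iff_count]
  intro x
  have hB : Multiset.count x (B.val.map (·⁻¹)) = if x⁻¹ ∈ B then 1 else 0 := by
    have := Multiset.count_map_eq_count' (·⁻¹) B.val (inv_injective (G := K)) x⁻¹
    rw [inv_inv] at this
    rw [this, Multiset.count_eq_of_nodup B.nodup]; rfl
  have hC : Multiset.count x (C.val.map (α * ·)) = if x / α ∈ C then 1 else 0 := by
    have := Multiset.count_map_eq_count' (α * ·) C.val (mul_right_injective₀ hα0) (x / α)
    rw [mul_div_cancel₀ _ hα0] at this
    rw [this, Multiset.count_eq_of_nodup C.nodup]; rfl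
  have hN : Multiset.count x ((Finset.univ : Finset (Fin 5)).val.map fun i => (b i)⁻¹ + α * c i) =
      (Finset.univ.filter fun i => (b i)⁻¹ + α * c i = x).card := by
    rw [Multiset.count_map]
    simp only [eq_comm]
    rfl
  rw [Multiset.count_add, Multiset.count_add, hB, hC, hN, Multiset.count_replicate]
  by_cases hx : x = 0
  · subst hx
    have e : (Finset.univ.filter fun i => (b i)⁻¹ + α * c i = 0) =
        (Finset.univ.filter fun i => a i = α) := by
      ext i
      simp only [Finset.mem_filter, Finset.mem_univ, true_and]
      have h1 := h.prod i
      have hb := h.b_ne i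
      have hc := h.c_ne i
      constructor
      · intro h2
        field_simp at h2
        exact mul_right_cancel₀ (mul_ne_zero hb hc) (by linear_combination h1 - h2)
      · intro h2
        field_simp
        rw [← h2]; linear_combination h1
    have := h.vertA α hα0
    simpa [e, h.zeroB, h.zeroC, hα] using this
  · have := h.join α x⁻¹ (x / α) (by field_simp)
    have e : (Finset.univ.filter fun i => (b i)⁻¹ + α * c i = x) =
        (Finset.univ.filter fun i => OnJoin (a i) (b i) α x⁻¹) := by
      ext i
      simp only [Finset.mem_filter, Finset.mem_univ, true_and]
      rw [onJoin_iff_inv (h.prod i) (inv_ne_zero hx), inv_inv]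
    rw [e]
    rw [if_pos hα] at this
    rw [if_neg (fun e => hx e.symm)]
    omega

lemma card_le_of_mem (h : TriangleConfig A B C u v w a b c) {α : K} (hα : α ∈ A) :
    1 + u + B.card + C.card ≤ 5 := by
  simpa using Multiset.card_le_card (h.pencil_le hα)

/-- If the lines through a removed side point carry exactly as many points as needed, then
the requirements are met exactly. -/
lemma pencil_eq (h : TriangleConfig A B C u v w a b c) {α : K} (hα : α ∈ A)
    (hc : u + B.card + C.card = 4) :
    Multiset.replicate (1 + u) 0 + B.val.map (·⁻¹) + C.val.map (α * ·) =
      (Finset.univ : Finset (Fin 5)).val.map fun i => (b i)⁻¹ + α * c i := by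
  apply Multiset.eq_of_le_of_card_le (h.pencil_le hα)
  simp
  omega

lemma pencil_sum (h : TriangleConfig A B C u v w a b c) {α : K} (hα : α ∈ A)
    (hc : u + B.card + C.card = 4) :
    ∑ β ∈ B, β⁻¹ + α * ∑ γ ∈ C, γ = ∑ i, (b i)⁻¹ + α * ∑ i, c i := by
  have := congrArg Multiset.sum (h.pencil_eq hα hc)
  simp only [Multiset.sum_add, Multiset.sum_replicate, smul_zero, zero_add] at this
  rw [Finset.mul_sum, Finset.mul_sum, ← Finset.sum_add_distrib]
  exact this

end TriangleConfig

/-! ### Balanced configurations: power sums and cubes -/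

namespace TriangleConfig

variable {A B C : Finset K} {a b c : Fin 5 → K}

/-- A configuration in which two non-vertex points are removed from each side. -/
structure Balanced (A B C : Finset K) (a b c : Fin 5 → K) : Prop where
  config : TriangleConfig A B C 0 0 0 a b c
  cardA : A.card = 2
  cardB : B.card = 2
  cardC : C.card = 2

namespace Balanced

lemma rotate (h : Balanced A B C a b c) : Balanced B C A b c a :=
  ⟨h.config.rotate, h.cardB, h.cardC, h.cardA⟩

lemma pencil_eq (h : Balanced A B C a b c) {α : K} (hα : α ∈ A) :
    0 ::ₘ (B.val.map (·⁻¹) + C.val.map (α * ·)) =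
      (Finset.univ : Finset (Fin 5)).val.map fun i => (b i)⁻¹ + α * c i := by
  have := h.config.pencil_eq hα (by rw [h.cardB, h.cardC])
  simpa using this

-- The tight pencil sums are affine identities in α that hold at two distinct values, so their
-- coefficients agree separately.
open Classical in
lemma sums (h : Balanced A B C a b c) :
    ∑ i, (b i)⁻¹ = ∑ β ∈ B, β⁻¹ ∧ ∑ i, c i = ∑ γ ∈ C, γ := by
  obtain ⟨x, y, hxy, hA⟩ := Finset.card_eq_two.1 h.cardA
  have h1 := h.config.pencil_sum (α := x) (by simp [hA]) (by rw [h.cardB, h.cardC])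
  have h2 := h.config.pencil_sum (α := y) (by simp [hA]) (by rw [h.cardB, h.cardC])
  have h3 : ∑ i, c i = ∑ γ ∈ C, γ := by
    apply mul_left_cancel₀ (sub_ne_zero.2 hxy)
    linear_combination h2 - h1
  refine ⟨?_, h3⟩
  rw [h3] at h1
  linear_combination -h1

lemma eq_zero_iff (h : Balanced A B C a b c) (α : K) (i : Fin 5) :
    (b i)⁻¹ + α * c i = 0 ↔ a i = α := by
  have h1 := h.config.prod i
  have hb := h.config.b_ne i
  have hc := h.config.c_ne i
  constructor
  · intro h2
    field_simp at h2
    exact mul_right_cancel₀ (mul_ne_zero hb hc) (by linear_combination h1 - h2)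
  · intro h2
    field_simp
    rw [← h2]; linear_combination h1

/-- This is the multiplicity of the label 0 in the tight pencil. -/
lemma existsUnique (h : Balanced A B C a b c) {α : K} (hα : α ∈ A) : ∃! i, a i = α := by
  classical
  have h1 := congrArg (Multiset.count 0) (h.pencil_eq hα)
  have hα0 : α ≠ 0 := fun e => h.config.zeroA (e ▸ hα)
  have hB : Multiset.count 0 (B.val.map (·⁻¹)) = 0 := by
    rw [Multiset.count_eq_zero]
    simpa using h.config.zeroB
  have hC : Multiset.count 0 (C.val.map (α * ·)) = 0 := by
    rw [Multiset.count_eq_zero]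
    simpa [hα0] using h.config.zeroC
  rw [Multiset.count_cons_self, Multiset.count_add, hB, hC, Multiset.count_map] at h1
  have h2 : (Finset.univ.filter fun i => a i = α).card = 1 := by
    rw [zero_add, zero_add] at h1
    refine Eq.trans ?_ h1.symm
    change _ = (Finset.univ.filter fun i => 0 = (b i)⁻¹ + α * c i).card
    congr 1
    ext i
    have := h.eq_zero_iff α i
    simp [this, eq_comm (a := (0 : K))]
  obtain ⟨i, hi⟩ := Finset.card_eq_one.1 h2
  refine ⟨i, by simpa using (Finset.ext_iff.1 hi i), fun j hj => by
    simpa [hj] using (Finset.ext_iff.1 hi j)⟩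

lemma unique (h : Balanced A B C a b c) {i j : Fin 5} (hi : a i ∈ A) (hij : a j = a i) : j = i :=
  (h.existsUnique hi).unique hij rfl

open Classical in
lemma sum_special (h : Balanced A B C a b c) {M : Type*} [AddCommMonoid M] (f : K → M) :
    ∑ i ∈ Finset.univ.filter (fun i => a i ∈ A), f (a i) = ∑ α ∈ A, f α := by
  refine Finset.sum_bij (fun i _ => a i) (by simp) ?_ ?_ (fun _ _ => rfl)
  · intro i hi j hj hij
    exact (h.unique (by simpa using hi) hij.symm).symm
  · intro α hα
    obtain ⟨i, hi, -⟩ := h.existsUnique hα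
    exact ⟨i, by simp [hi, hα], hi⟩

open Classical in
lemma card_special (h : Balanced A B C a b c) :
    (Finset.univ.filter (fun i => a i ∈ A)).card = 2 := by
  have := h.sum_special (fun _ => 1)
  simpa [h.cardA] using this

/-- Cancelling the two special terms from the sums of the a's and of their inverses leaves three
parameters with e₁ = e₂ = 0. They are the roots of some X³ - d, which is the source of all cube
relations. -/
lemma exists_ordinary (h : Balanced A B C a b c) : ∃ i j k, i ≠ j ∧ i ≠ k ∧ j ≠ k ∧
    (∀ l, a l ∉ A ↔ l = i ∨ l = j ∨ l = k) ∧ a i + a j + a k = 0 ∧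
    a i * a j + a i * a k + a j * a k = 0 := by
  classical
  have hc : (Finset.univ.filter (fun i => a i ∉ A)).card = 3 := by
    have := Finset.card_filter_add_card_filter_not (s := (Finset.univ : Finset (Fin 5)))
      (fun i => a i ∈ A)
    rw [h.card_special] at this
    simp at this
    omega
  obtain ⟨i, j, k, hij, hik, hjk, hS⟩ := Finset.card_eq_three.1 hc
  have hf : ∀ f : K → K, ∑ i, f (a i) = ∑ α ∈ A, f α → f (a i) + f (a j) + f (a k) = 0 := by
    intro f hf
    have := Finset.sum_filter_add_sum_filter_not (Finset.univ : Finset (Fin 5))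
      (fun i => a i ∈ A) (fun i => f (a i))
    rw [h.sum_special, hf, hS] at this
    rw [Finset.sum_insert (by simp [hij, hik]), Finset.sum_insert (by simp [hjk]),
      Finset.sum_singleton] at this
    linear_combination this
  refine ⟨i, j, k, hij, hik, hjk, fun l => ?_, hf id h.rotate.sums.2, ?_⟩
  · simpa using Finset.ext_iff.1 hS l
  · have := hf _ h.rotate.rotate.sums.1
    have hi := h.config.a_ne i
    have hj := h.config.a_ne j
    have hk := h.config.a_ne k
    field_simp at this
    linear_combination this

lemma roots (h : Balanced A B C a b c) {i j : Fin 5} (hij : i ≠ j) (hi : a i ∉ A)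
    (hj : a j ∉ A) : a i ^ 2 + a i * a j + a j ^ 2 = 0 := by
  obtain ⟨x, y, z, -, -, -, hS, h1, h2⟩ := h.exists_ordinary
  rw [hS] at hi hj
  grind

lemma sum_eq_zero (h : Balanced A B C a b c) {i j k : Fin 5} (hij : i ≠ j) (hik : i ≠ k)
    (hjk : j ≠ k) (hi : a i ∉ A) (hj : a j ∉ A) (hk : a k ∉ A) : a i + a j + a k = 0 := by
  obtain ⟨x, y, z, -, -, -, hS, h1, h2⟩ := h.exists_ordinary
  rw [hS] at hi hj hk
  grind

lemma cube_eq (h : Balanced A B C a b c) {i j : Fin 5} (hi : a i ∉ A)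
    (hj : a j ∉ A) : a i ^ 3 = a j ^ 3 := by
  by_cases hij : i = j
  · rw [hij]
  linear_combination (a i - a j) * h.roots hij hi hj

/-- X³ - d splits with precisely the three ordinary parameters as roots, so a removed parameter with
the same cube would be one of them. -/
lemma cube_ne (h : Balanced A B C a b c) {α : K} (hα : α ∈ A) {i : Fin 5} (hi : a i ∉ A) :
    α ^ 3 ≠ a i ^ 3 := by
  obtain ⟨x, y, z, -, -, -, hS, h1, h2⟩ := h.exists_ordinary
  intro he
  have h3 : a i ^ 3 = a x * a y * a z := by
    rcases (hS i).1 hi with rfl | rfl | rfl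
    · linear_combination a i ^ 2 * h1 - a i * h2
    · linear_combination a i ^ 2 * h1 - a i * h2
    · linear_combination a i ^ 2 * h1 - a i * h2
  have h4 : (α - a x) * ((α - a y) * (α - a z)) = 0 := by
    linear_combination he + h3 - α ^ 2 * h1 + α * h2
  rcases mul_eq_zero.1 h4 with h4 | h4
  · exact (hS x).2 (by simp) (sub_eq_zero.1 h4 ▸ hα)
  rcases mul_eq_zero.1 h4 with h4 | h4
  · exact (hS y).2 (by simp) (sub_eq_zero.1 h4 ▸ hα)
  · exact (hS z).2 (by simp) (sub_eq_zero.1 h4 ▸ hα)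

/-- Every line through a removed point and a new point is needed. -/
lemma meet (h : Balanced A B C a b c) {α : K} (hα : α ∈ A) (i : Fin 5) :
    a i = α ∨ (∃ β ∈ B, OnJoin (a i) (b i) α β) ∨ ∃ γ ∈ C, OnJoin (c i) (a i) γ α := by
  have hα0 : α ≠ 0 := fun e => h.config.zeroA (e ▸ hα)
  have h1 : (b i)⁻¹ + α * c i ∈ 0 ::ₘ (B.val.map (·⁻¹) + C.val.map (α * ·)) := by
    rw [h.pencil_eq hα]
    exact Multiset.mem_map_of_mem _ (Finset.mem_univ i)
  rw [Multiset.mem_cons, Multiset.mem_add, Multiset.mem_map, Multiset.mem_map] at h1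
  rcases h1 with h1 | ⟨β, hβ, h1⟩ | ⟨γ, hγ, h1⟩
  · exact Or.inl ((h.eq_zero_iff α i).1 h1)
  · refine Or.inr (Or.inl ⟨β, hβ, ?_⟩)
    rw [onJoin_iff_inv (h.config.prod i) (fun e => h.config.zeroB (e ▸ hβ))]
    exact h1.symm
  · refine Or.inr (Or.inr ⟨γ, hγ, ?_⟩)
    have hb := h.config.b_ne i
    have h2 := h.config.prod i
    unfold OnJoin
    field_simp at h1
    linear_combination -(a i * c i) * h1 + (α * γ - α * c i) * h2

/-- A line through three removed points keeps no point of the triangle, hence needs at least two new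
points. -/
lemma exists_ne (h : Balanced A B C a b c) {α β γ : K} (hα : α ∈ A) (hβ : β ∈ B) (hγ : γ ∈ C)
    (hl : α * β * γ = 1) (i : Fin 5) : ∃ j, j ≠ i ∧ OnJoin (a j) (b j) α β := by
  classical
  have h1 := h.config.join α β γ hl
  rw [if_pos hα, if_pos hβ, if_pos hγ] at h1
  have h2 : 1 < (Finset.univ.filter fun i => OnJoin (a i) (b i) α β).card := by omega
  obtain ⟨j, hj, hji⟩ := Finset.exists_mem_ne h2 i
  exact ⟨j, hji, by simpa using hj⟩

end Balanced

end TriangleConfig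

/-! ### Uniqueness rules for joins -/

lemma OnJoin.trans {a b c α β γ : K} (h : a * b * c = -1)
    (h1 : OnJoin a b α β) (h2 : OnJoin b c β γ) : α * β * γ = 1 := by
  unfold OnJoin at *
  have hb : b ≠ 0 := by rintro rfl; simp at h
  have hc : c ≠ 0 := by rintro rfl; simp at h
  have hd : b - β ≠ 0 := by
    intro e
    have : b * c = 0 := by linear_combination h2 + γ * e
    simp [hb, hc] at this
  apply mul_left_cancel₀ hd
  linear_combination -(α * β) * h2 + b * c * h1 + (β - b) * h

lemma OnJoin.left_unique {a b α α' β : K} (hβ : β ≠ 0) (h1 : OnJoin a b α β)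
    (h2 : OnJoin a b α' β) : α = α' := by
  unfold OnJoin at *
  exact mul_right_cancel₀ hβ (by linear_combination h1 - h2)

lemma OnJoin.right_unique {a b α β β' : K} (ha : a ≠ 0) (hb : b ≠ 0) (h1 : OnJoin a b α β)
    (h2 : OnJoin a b α β') : β = β' := by
  unfold OnJoin at *
  have hd : a - α ≠ 0 := by
    intro e
    have : a * b = 0 := by linear_combination h1 + β * e
    simp [ha, hb] at this
  exact mul_right_cancel₀ hd (by linear_combination h2 - h1)

lemma not_onJoin_left {a b β : K} (ha : a ≠ 0) (hb : b ≠ 0) : ¬ OnJoin a b a β := by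
  intro h
  unfold OnJoin at h
  have : a * b = 0 := by linear_combination h
  simp [ha, hb] at this

lemma not_onJoin_right {a b α : K} (hα : α ≠ 0) (hb : b ≠ 0) : ¬ OnJoin a b α b := by
  intro h
  unfold OnJoin at h
  have : α * b = 0 := by linear_combination h
  simp [hα, hb] at this

lemma exists_other {X : Type*} {A : Finset X} (hA : A.card = 2) {α : X} (hα : α ∈ A) :
    ∃ α' ∈ A, α' ≠ α ∧ ∀ x ∈ A, x = α ∨ x = α' := by
  classical
  obtain ⟨x, y, hxy, rfl⟩ := Finset.card_eq_two.1 hA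
  simp only [Finset.mem_insert, Finset.mem_singleton] at hα ⊢
  rcases hα with rfl | rfl
  · exact ⟨y, by simp, hxy.symm, by simp⟩
  · exact ⟨x, by simp, hxy, by grind⟩

lemma eq_or_eq_of_card_two {X : Type*} {A : Finset X} (hA : A.card = 2) {α β x : X} (hα : α ∈ A) (hβ : β ∈ A)
    (hne : α ≠ β) (hx : x ∈ A) : x = α ∨ x = β := by
  classical
  obtain ⟨y, z, hxy, rfl⟩ := Finset.card_eq_two.1 hA
  simp only [Finset.mem_insert, Finset.mem_singleton] at hα hβ hx
  grind

/-! ### Excluding the spread pattern and two triply special points -/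

namespace TriangleConfig.Balanced

variable {A B C : Finset K} {a b c : Fin 5 → K}

lemma mem_ne (h : Balanced A B C a b c) {α : K} (hα : α ∈ A) : α ≠ 0 :=
  fun e => h.config.zeroA (e ▸ hα)

lemma a_ne (h : Balanced A B C a b c) (i : Fin 5) : a i ≠ 0 := h.config.a_ne i

lemma trans (h : Balanced A B C a b c) {i : Fin 5} {α β γ : K}
    (h1 : OnJoin (a i) (b i) α β) (h2 : OnJoin (b i) (c i) β γ) : OnJoin (c i) (a i) γ α := by
  have hl := OnJoin.trans (h.config.prod i) h1 h2
  exact OnJoin.rotate (by linear_combination h.config.prod i) (by linear_combination hl) h2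

/-- A new point which lies on the line joining exactly one removed point to the opposite vertex
lies on a line with three removed points. -/
lemma exists_triple (h : Balanced A B C a b c) {i : Fin 5} (ha : a i ∉ A) (hb : b i ∉ B)
    (hc : c i ∈ C) {γ : K} (hγ : γ ∈ C) (hγi : γ ≠ c i) :
    ∃ α ∈ A, ∃ β ∈ B, OnJoin (a i) (b i) α β ∧ OnJoin (b i) (c i) β γ ∧
      OnJoin (c i) (a i) γ α := by
  -- Lines through the new point partition the five removed points other than c i, with at most one
  -- point per side in a block. `meet` forbids singletons, so the blocks have sizes 2 and 3, and the
  -- larger one contains γ. The case analysis traces this partition.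
  have key : ∃ α ∈ A, OnJoin (c i) (a i) γ α := by
    rcases h.rotate.rotate.meet hγ i with e | h1 | ⟨β, hβ, h1⟩
    · exact absurd e.symm hγi
    · exact h1
    obtain ⟨β', hβ', hne, hβs⟩ := exists_other h.cardB hβ
    rcases h.rotate.meet hβ' i with e | ⟨γ', hγ', h2⟩ | ⟨α, hα, h2⟩
    · exact absurd (e ▸ hβ') hb
    · rcases eq_or_eq_of_card_two h.cardC hγ hc hγi hγ' with rfl | rfl
      · exact absurd (h2.left_unique (h.rotate.rotate.mem_ne hγ) h1) hne
      · exact absurd h2 (not_onJoin_right (h.rotate.mem_ne hβ') (h.rotate.rotate.a_ne i))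
    obtain ⟨α', hα', hne', hαs⟩ := exists_other h.cardA hα
    refine ⟨α', hα', ?_⟩
    rcases h.meet hα' i with e | ⟨β'', hβ'', h3⟩ | ⟨γ', hγ', h3⟩
    · exact absurd (e ▸ hα') ha
    · rcases hβs β'' hβ'' with rfl | rfl
      · exact h.trans h3 h1
      · exact absurd (h3.left_unique (h.rotate.mem_ne hβ') h2) hne'
    · rcases eq_or_eq_of_card_two h.cardC hγ hc hγi hγ' with rfl | rfl
      · exact h3
      · exact absurd h3 (not_onJoin_left (h.rotate.rotate.a_ne i) (h.a_ne i))
  obtain ⟨α, hα, h1⟩ := key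
  obtain ⟨α', hα', hne', hαs⟩ := exists_other h.cardA hα
  rcases h.meet hα' i with e | ⟨β, hβ, h2⟩ | ⟨γ', hγ', h2⟩
  · exact absurd (e ▸ hα') ha
  · obtain ⟨β', hβ', hne, hβs⟩ := exists_other h.cardB hβ
    rcases h.rotate.meet hβ' i with e | ⟨γ', hγ', h3⟩ | ⟨α'', hα'', h3⟩
    · exact absurd (e ▸ hβ') hb
    · rcases eq_or_eq_of_card_two h.cardC hγ hc hγi hγ' with rfl | rfl
      · exact ⟨α, hα, β', hβ', h.rotate.trans h3 h1, h3, h1⟩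
      · exact absurd h3 (not_onJoin_right (h.rotate.mem_ne hβ') (h.rotate.rotate.a_ne i))
    · rcases hαs α'' hα'' with rfl | rfl
      · exact ⟨_, hα, β', hβ', h3, h.rotate.rotate.trans h1 h3, h1⟩
      · exact absurd (h3.right_unique (h.a_ne i) (h.rotate.a_ne i) h2) hne
  · rcases eq_or_eq_of_card_two h.cardC hγ hc hγi hγ' with rfl | rfl
    · exact absurd (h2.right_unique (h.rotate.rotate.a_ne i) (h.a_ne i) h1) hne'
    · exact absurd h2 (not_onJoin_left (h.rotate.rotate.a_ne i) (h.a_ne i))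

/-- The triple line through r must contain a second new point. If it avoided both projections of s,
it would contain the projections of p, q and r', excluding those points; s itself would then leave
the line from s to c r without a second removed point. -/
lemma spread_aux (h : Balanced A B C a b c) {p q r r' s : Fin 5}
    (hps : p ≠ s) (hqs : q ≠ s) (hrr : c r' ≠ c r) (hcov : ∀ i, i = p ∨ i = q ∨ i = r ∨ i = r' ∨ i = s)
    (pa : a p ∈ A) (qb : b q ∈ B) (rc : c r ∈ C) (rc' : c r' ∈ C) (sa : a s ∈ A) (sb : b s ∈ B)
    (ra : a r ∉ A) (rb : b r ∉ B) (sc : c s ∉ C) :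
    ∃ α ∈ A, ∃ β ∈ B, OnJoin (a r) (b r) α β ∧ OnJoin (b r) (c r) β (c r') ∧
      OnJoin (c r) (a r) (c r') α ∧ (α = a s ∨ β = b s) := by
  obtain ⟨α, hα, β, hβ, h1, h2, h3⟩ := h.exists_triple ra rb rc rc' hrr
  refine ⟨α, hα, β, hβ, h1, h2, h3, ?_⟩
  have hl := OnJoin.trans (h.config.prod r) h1 h2
  have hpa : a p ≠ a s := fun e => hps (h.unique sa e)
  have hqb : b q ≠ b s := fun e => hqs (h.rotate.unique sb e)
  obtain ⟨j, hj, hon⟩ := h.exists_ne hα hβ rc' hl r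
  have hon2 := hon.rotate (h.config.prod j) hl
  have hon3 := h.trans hon hon2
  by_contra hne
  push Not at hne
  rcases hcov j with rfl | rfl | rfl | rfl | rfl
  · rcases eq_or_eq_of_card_two h.cardA sa pa hpa.symm hα with e | rfl
    · exact hne.1 e
    · exact not_onJoin_left (h.a_ne _) (h.rotate.a_ne _) hon
  · rcases eq_or_eq_of_card_two h.cardB sb qb hqb.symm hβ with e | rfl
    · exact hne.2 e
    · exact not_onJoin_right (h.mem_ne hα) (h.rotate.a_ne _) hon
  · exact hj rfl
  · exact not_onJoin_left (h.rotate.rotate.a_ne _) (h.a_ne _) hon3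
  · rcases h.rotate.rotate.meet rc j with e | ⟨α', hα', h4⟩ | ⟨β', hβ', h4⟩
    · exact sc (e ▸ rc)
    · rcases eq_or_eq_of_card_two h.cardA sa hα hne.1.symm hα' with rfl | rfl
      · exact not_onJoin_right (h.rotate.rotate.mem_ne rc) (h.a_ne _) h4
      · exact hrr (hon3.left_unique (h.mem_ne hα) h4)
    · rcases eq_or_eq_of_card_two h.cardB sb hβ hne.2.symm hβ' with rfl | rfl
      · exact not_onJoin_left (h.rotate.a_ne _) (h.rotate.rotate.a_ne _) h4
      · exact hrr (hon2.right_unique (h.rotate.a_ne _) (h.rotate.rotate.a_ne _) h4)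

/-- No configuration with one doubly special point and four simply special ones. -/
lemma not_spread (h : Balanced A B C a b c) {p q r r' s : Fin 5}
    (hps : p ≠ s) (hqs : q ≠ s) (hrr : r ≠ r') (hcov : ∀ i, i = p ∨ i = q ∨ i = r ∨ i = r' ∨ i = s)
    (pa : a p ∈ A) (qb : b q ∈ B) (rc : c r ∈ C) (rc' : c r' ∈ C) (sa : a s ∈ A) (sb : b s ∈ B)
    (ra : a r ∉ A) (rb : b r ∉ B) (ra' : a r' ∉ A) (rb' : b r' ∉ B) (sc : c s ∉ C) : False := by
  have hc : c r' ≠ c r := fun e => hrr (h.rotate.rotate.unique rc e).symm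
  obtain ⟨α, hα, β, hβ, h1, h2, h3, h4⟩ := h.spread_aux hps hqs hc hcov pa qb rc rc' sa sb ra rb sc
  obtain ⟨α', hα', β', hβ', h1', h2', h3', h4'⟩ := h.spread_aux hps hqs hc.symm
    (fun i => by have := hcov i; tauto) pa qb rc' rc sa sb ra' rb' sc
  have e1 := h.roots hrr ra ra'
  have e2 := h.rotate.roots hrr rb rb'
  have a0 := h.a_ne r
  have b0 := h.rotate.a_ne r
  have c0 := h.rotate.rotate.a_ne r
  have c0' := h.rotate.rotate.a_ne r'
  have p1 := h.config.prod r
  have p2 := h.config.prod r'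
  have p3 := h.config.prod s
  have hcube := h.rotate.rotate.cube_ne rc sc
  obtain ⟨ω, hω⟩ : ∃ ω, a r' = ω * a r := ⟨a r' / a r, by field_simp⟩
  obtain ⟨ρ, hρ⟩ : ∃ ρ, b r' = ρ * b r := ⟨b r' / b r, by field_simp⟩
  rw [hω] at e1 p2
  rw [hρ] at e2 p2
  have e1 : ω ^ 2 + ω + 1 = 0 := by
    apply mul_left_cancel₀ (pow_ne_zero 2 a0); linear_combination e1
  have e2 : ρ ^ 2 + ρ + 1 = 0 := by
    apply mul_left_cancel₀ (pow_ne_zero 2 b0); linear_combination e2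
  have hab : a r * b r ≠ 0 := mul_ne_zero a0 b0
  have p2' : ω * ρ * c r' = c r := by
    apply mul_left_cancel₀ hab; linear_combination p2 - p1
  have hρω : ρ = ω := by
    have : (ω - ρ) * (ω + ρ + 1) = 0 := by linear_combination e1 - e2
    rcases mul_eq_zero.1 this with e | e
    · linear_combination -e
    · exfalso
      apply hc
      have : ω * ρ = 1 := by linear_combination ω * e - e1
      rw [← p2', this, one_mul]
  subst hρω
  have hcc : c r' = ρ * c r := by
    rw [← p2']; linear_combination -(ρ - 1) * e1 * c r'
  have hρ0 : ρ ≠ 0 := by rintro rfl; simp at e1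
  unfold OnJoin at *
  rw [hcc] at h2 h3 h2' h3'
  rw [hω] at h3'
  rw [hρ] at h2'
  have k1 : α * (1 - ρ) = a r := by
    apply mul_left_cancel₀ c0; linear_combination -h3
  have k2 : β * ρ = b r * (ρ - 1) := by
    apply mul_left_cancel₀ c0; linear_combination h2
  have k3 : α' * (1 - ρ ^ 2) = ρ * a r := by
    apply mul_left_cancel₀ c0; linear_combination (1 + ρ) * h3' - c r * a r * ρ * e1
  have k4 : β' * ρ ^ 2 = ρ * b r * (ρ ^ 2 - 1) := by
    apply mul_left_cancel₀ c0; linear_combination ρ ^ 2 * h2' - c r * b r * ρ * (ρ - 1) * e1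
  have hρ1 : 1 - ρ ≠ 0 := by
    intro e; rw [e, mul_zero] at k1; exact a0 k1.symm
  clear h1 h2 h3 h1' h2' h3' hcov
  -- This relation would make c r and c s differ by a cube root of unity, although one is removed
  -- and the other ordinary.
  have fin : a s * b s = ρ * (a r * b r) → False := by
    intro e
    apply hcube
    have e3 : c r = ρ * c s := by
      apply mul_left_cancel₀ hab
      linear_combination p1 - p3 + c s * e
    rw [e3]
    linear_combination (ρ - 1) * e1 * c s ^ 3
  rcases h4 with rfl | rfl <;> rcases h4' with e' | e'
  · rw [e'] at k3
    grind
  · rw [e'] at k4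
    apply fin
    grind
  · rw [e'] at k3
    apply fin
    grind
  · rw [e'] at k4
    grind

/-- No configuration with two triply special points. -/
lemma not_doubled (h : Balanced A B C a b c) {s t : Fin 5} (hst : s ≠ t)
    (sa : a s ∈ A) (sb : b s ∈ B) (sc : c s ∈ C) (ta : a t ∈ A) (tb : b t ∈ B) (tc : c t ∈ C)
    (hA : ∀ i, i ≠ s → i ≠ t → a i ∉ A) : False := by
  have na : a s ≠ a t := fun e => hst (h.unique ta e)
  have nb : b s ≠ b t := fun e => hst (h.rotate.unique tb e)
  have nc : c s ≠ c t := fun e => hst (h.rotate.rotate.unique tc e)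
  have h' := h.rotate
  have h'' := h'.rotate
  -- Lines through s partition the projections of t without singletons, so all three lie on one line
  -- through s.
  have key : ∀ s t : Fin 5, a s ∈ A → b s ∈ B → c s ∈ C → a t ∈ A → b t ∈ B → c t ∈ C →
      a s ≠ a t → b s ≠ b t → c s ≠ c t → OnJoin (a s) (b s) (a t) (b t) ∧
      OnJoin (b s) (c s) (b t) (c t) := by
    intro s t sa sb sc ta tb tc na nb nc
    have m1 : OnJoin (a s) (b s) (a t) (b t) ∨ OnJoin (c s) (a s) (c t) (a t) := by
      rcases h.meet ta s with e | ⟨β, hβ, e⟩ | ⟨γ, hγ, e⟩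
      · exact absurd e na
      · rcases eq_or_eq_of_card_two h.cardB sb tb nb hβ with rfl | rfl
        · exact absurd e (not_onJoin_right (h.mem_ne ta) (h'.a_ne _))
        · exact Or.inl e
      · rcases eq_or_eq_of_card_two h.cardC sc tc nc hγ with rfl | rfl
        · exact absurd e (not_onJoin_left (h''.a_ne _) (h.a_ne _))
        · exact Or.inr e
    have m2 : OnJoin (b s) (c s) (b t) (c t) ∨ OnJoin (a s) (b s) (a t) (b t) := by
      rcases h'.meet tb s with e | ⟨β, hβ, e⟩ | ⟨γ, hγ, e⟩
      · exact absurd e nb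
      · rcases eq_or_eq_of_card_two h.cardC sc tc nc hβ with rfl | rfl
        · exact absurd e (not_onJoin_right (h'.mem_ne tb) (h''.a_ne _))
        · exact Or.inl e
      · rcases eq_or_eq_of_card_two h.cardA sa ta na hγ with rfl | rfl
        · exact absurd e (not_onJoin_left (h.a_ne _) (h'.a_ne _))
        · exact Or.inr e
    have m3 : OnJoin (c s) (a s) (c t) (a t) ∨ OnJoin (b s) (c s) (b t) (c t) := by
      rcases h''.meet tc s with e | ⟨β, hβ, e⟩ | ⟨γ, hγ, e⟩
      · exact absurd e nc
      · rcases eq_or_eq_of_card_two h.cardA sa ta na hβ with rfl | rfl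
        · exact absurd e (not_onJoin_right (h''.mem_ne tc) (h.a_ne _))
        · exact Or.inl e
      · rcases eq_or_eq_of_card_two h.cardB sb tb nb hγ with rfl | rfl
        · exact absurd e (not_onJoin_left (h'.a_ne _) (h''.a_ne _))
        · exact Or.inr e
    have t1 := h.trans (α := a t) (β := b t) (γ := c t) (i := s)
    have t2 := h'.trans (α := b t) (β := c t) (γ := a t) (i := s)
    have t3 := h''.trans (α := c t) (β := a t) (γ := b t) (i := s)
    tauto
  obtain ⟨h1, h2⟩ := key s t sa sb sc ta tb tc na nb nc
  obtain ⟨h3, h4⟩ := key t s ta tb tc sa sb sc na.symm nb.symm nc.symm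
  have hl := OnJoin.trans (h.config.prod s) h1 h2
  have hl' := OnJoin.trans (h.config.prod t) h3 h4
  -- The projections of t have product 1 by collinearity and -1 by the relation for new points, so
  -- the characteristic is 2.
  have h20 : (1 : K) = -1 := hl.symm.trans (h.config.prod t)
  obtain ⟨j, hjs, hon⟩ := h.exists_ne ta tb tc hl s
  have hjt : j ≠ t := by
    rintro rfl
    exact not_onJoin_left (h.a_ne _) (h'.a_ne _) hon
  have hja := hA j hjs hjt
  have hon' : OnJoin (a j) (b j) (a s) (b s) := by
    rcases h.meet sa j with e | ⟨β, hβ, e⟩ | ⟨γ, hγ, e⟩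
    · exact absurd (e ▸ sa) hja
    · rcases eq_or_eq_of_card_two h.cardB sb tb nb hβ with rfl | rfl
      · exact e
      · exact absurd (e.left_unique (h'.mem_ne tb) hon) na
    · have hon3 := h.trans hon (hon.rotate (h.config.prod j) hl)
      rcases eq_or_eq_of_card_two h.cardC sc tc nc hγ with rfl | rfl
      · exact e.rotate (by linear_combination h.config.prod j) (by linear_combination hl')
      · exact absurd (e.right_unique (h''.a_ne _) (h.a_ne _) hon3) na
  have hcube := h.cube_ne sa hja
  have a0 := h.mem_ne sa
  have b0 := h'.mem_ne sb
  have b0' := h'.mem_ne tb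
  have aj := h.a_ne j
  have bj := h'.a_ne j
  unfold OnJoin at *
  clear h2 h4 hl hl' key hA
  obtain ⟨u, hu⟩ : ∃ u, a t = u * a s := ⟨a t / a s, by field_simp⟩
  obtain ⟨v, hv⟩ : ∃ v, b t = v * b s := ⟨b t / b s, by field_simp⟩
  rw [hu, hv] at h1 h3
  rw [hu, hv] at hon
  have hab : a s * b s ≠ 0 := mul_ne_zero a0 b0
  have k1 : u * v + 1 = v := by apply mul_left_cancel₀ hab; linear_combination h1
  have k2 : 1 + u * v = u := by apply mul_left_cancel₀ hab; linear_combination h3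
  have huv : u = v := by linear_combination k1 - k2
  subst huv
  have hu1 : u - 1 ≠ 0 := by
    intro e
    apply one_ne_zero (α := K)
    linear_combination k1 - u * e
  have k3 : (u + 1) * a s = a j := by
    apply mul_left_cancel₀ (mul_ne_zero hu1 b0)
    linear_combination hon - hon'
  -- In characteristic 2, k1 reads u² + u + 1 = 0, so u + 1 is a cube root of unity and a j has the
  -- cube of a removed parameter.
  apply hcube
  rw [← k3]
  linear_combination (-a s ^ 3 * (u + 4)) * k1 + a s ^ 3 * (2 - 3 * u) * h20

end TriangleConfig.Balanced

/-! ### Excluding three doubly special points -/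

/-- In coordinates divided by those of an ordinary point, the doubly special points are s = (x, y,
ω²), t = (ω², y', z), r = (x', ω², z'). The first three equations are the product relations; the
disjunction records the two ways in which lines through s pair removed points. -/
lemma cyclic_relation {ω x x' y y' z z' : K} (hω : ω ^ 2 + ω + 1 = 0) (h1 : x * y = ω)
    (h2 : y' * z = ω) (h3 : z' * x' = ω)
    (h : z * x' + ω ^ 2 * x = ω ^ 2 * x' ∧ y' * z' + y * ω ^ 2 = y * z' ∨
      z' * x' + ω ^ 2 * x = ω ^ 2 * x' ∧ y' * z + y * ω ^ 2 = y * z) :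
    x' * y' = ω := by
  have hω0 : ω ≠ 0 := by rintro rfl; simp at hω
  rcases h with ⟨e1, e2⟩ | ⟨e1, e2⟩ <;> grind

/-- Here all coordinates have been reduced to x and x'. The first disjunction is an incidence of s,
the second an incidence of the ordinary point l. -/
lemma cyclic_contradiction {ω x x' : K} (hω : ω ^ 2 + ω + 1 = 0) (hx : x * x' = ω)
    (hx3 : x ^ 3 ≠ 1)
    (h1 : x' * x' + ω ^ 2 * x = ω ^ 2 * x' ∨ ω + ω ^ 2 * x = ω ^ 2 * x')
    (h2 : ω + 1 = x' ∨ x * x + 1 = x ∨ ω + 1 = x) : False := by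
  have hω0 : ω ≠ 0 := by rintro rfl; simp at hω
  have hx0 : x ≠ 0 := by rintro rfl; simp at hx; exact hω0 hx.symm
  rcases h1 with h1 | h1 <;> rcases h2 with h2 | h2 | h2
  all_goals grind

namespace TriangleConfig.Balanced

variable {A B C : Finset K} {a b c : Fin 5 → K}

/-- The removed points other than the projections of s are a r, b t, c t, c r. Lines through s leave
none alone and separate the two on the same side, so one of c t, c r is paired with a r and the
other with b t. -/
lemma cyclic_aux (h : Balanced A B C a b c) {l s t r : Fin 5} {ω : K} (hω : ω ^ 2 + ω + 1 = 0)
    (ht : a t = ω ^ 2 * a l) (hr : b r = ω ^ 2 * b l) (hs : c s = ω ^ 2 * c l)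
    (sa : a s ∈ A) (sb : b s ∈ B) (tb : b t ∈ B) (tc : c t ∈ C) (rc : c r ∈ C) (ra : a r ∈ A)
    (na : a s ≠ a r) (nb : b s ≠ b t) (nc : c t ≠ c r) (sc : c s ∉ C) :
    a r * b t = ω * (a l * b l) ∧
    (OnJoin (c s) (a s) (c t) (a r) ∨ OnJoin (c s) (a s) (c r) (a r)) := by
  have h' := h.rotate
  have h'' := h'.rotate
  have key : ∀ γ ∈ C, OnJoin (c s) (a s) γ (a r) ∨ OnJoin (b s) (c s) (b t) γ := by
    intro γ hγ
    rcases h''.meet hγ s with e | ⟨α, hα, e⟩ | ⟨β, hβ, e⟩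
    · exact absurd (e ▸ hγ) sc
    · rcases eq_or_eq_of_card_two h.cardA sa ra na hα with rfl | rfl
      · exact absurd e (not_onJoin_right (h''.mem_ne hγ) (h.a_ne _))
      · exact Or.inl e
    · rcases eq_or_eq_of_card_two h.cardB sb tb nb hβ with rfl | rfl
      · exact absurd e (not_onJoin_left (h'.a_ne _) (h''.a_ne _))
      · exact Or.inr e
  have key2 : OnJoin (c s) (a s) (c t) (a r) ∧ OnJoin (b s) (c s) (b t) (c r) ∨
      OnJoin (c s) (a s) (c r) (a r) ∧ OnJoin (b s) (c s) (b t) (c t) := by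
    rcases key _ tc with e1 | e1 <;> rcases key _ rc with e2 | e2
    · exact absurd (e1.left_unique (h.mem_ne ra) e2) nc
    · exact Or.inl ⟨e1, e2⟩
    · exact Or.inr ⟨e2, e1⟩
    · exact absurd (e1.right_unique (h'.a_ne _) (h''.a_ne _) e2) nc
  refine ⟨?_, key2.imp And.left And.left⟩
  have a0 := h.a_ne l
  have b0 := h'.a_ne l
  have c0 := h''.a_ne l
  have p0 := h.config.prod l
  have p1 := h.config.prod s
  have p2 := h.config.prod t
  have p3 := h.config.prod r
  obtain ⟨x, hx⟩ : ∃ x, a s = x * a l := ⟨a s / a l, by field_simp⟩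
  obtain ⟨x', hx'⟩ : ∃ x, a r = x * a l := ⟨a r / a l, by field_simp⟩
  obtain ⟨y, hy⟩ : ∃ x, b s = x * b l := ⟨b s / b l, by field_simp⟩
  obtain ⟨y', hy'⟩ : ∃ x, b t = x * b l := ⟨b t / b l, by field_simp⟩
  obtain ⟨z, hz⟩ : ∃ x, c t = x * c l := ⟨c t / c l, by field_simp⟩
  obtain ⟨z', hz'⟩ : ∃ x, c r = x * c l := ⟨c r / c l, by field_simp⟩
  unfold OnJoin at key2
  rw [hx, hx', hy, hy', hz, hz', hs] at key2
  rw [hx, hy, hs] at p1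
  rw [ht, hy', hz] at p2
  rw [hx', hr, hz'] at p3
  have := cyclic_relation (x := x) (x' := x') (y := y) (y' := y') (z := z) (z' := z') hω
    (by linear_combination -ω * p1 + ω * x * y * ω ^ 2 * p0 + (1 - ω) * (x * y) * hω)
    (by linear_combination -ω * p2 + ω * y' * z * ω ^ 2 * p0 + (1 - ω) * (y' * z) * hω)
    (by linear_combination -ω * p3 + ω * z' * x' * ω ^ 2 * p0 + (1 - ω) * (z' * x') * hω)
    (by
      refine key2.imp (fun e => ⟨?_, ?_⟩) (fun e => ⟨?_, ?_⟩)
      · exact mul_left_cancel₀ (mul_ne_zero c0 a0) (by linear_combination e.1)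
      · exact mul_left_cancel₀ (mul_ne_zero b0 c0) (by linear_combination e.2)
      · exact mul_left_cancel₀ (mul_ne_zero c0 a0) (by linear_combination e.1)
      · exact mul_left_cancel₀ (mul_ne_zero b0 c0) (by linear_combination e.2))
  rw [hx', hy']
  linear_combination a l * b l * this

lemma ordinary_ratio (h : Balanced A B C a b c) {l l' : Fin 5} (hl : l ≠ l') (la : a l ∉ A)
    (lb : b l ∉ B) (lc : c l ∉ C) (la' : a l' ∉ A) (lb' : b l' ∉ B) (lc' : c l' ∉ C) :
    ∃ ω, ω ^ 2 + ω + 1 = 0 ∧ a l' = ω * a l ∧ b l' = ω * b l ∧ c l' = ω * c l := by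
  have e1 := h.roots hl la la'
  have e2 := h.rotate.roots hl lb lb'
  have e3 := h.rotate.rotate.roots hl lc lc'
  have a0 := h.a_ne l
  have b0 := h.rotate.a_ne l
  have c0 := h.rotate.rotate.a_ne l
  have p1 := h.config.prod l
  have p2 := h.config.prod l'
  have hinj := h.config.inj l' l
  obtain ⟨ω, hω⟩ : ∃ ω, a l' = ω * a l := ⟨a l' / a l, by field_simp⟩
  obtain ⟨ρ, hρ⟩ : ∃ ρ, b l' = ρ * b l := ⟨b l' / b l, by field_simp⟩
  obtain ⟨σ, hσ⟩ : ∃ σ, c l' = σ * c l := ⟨c l' / c l, by field_simp⟩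
  rw [hω, hρ, hσ] at p2
  rw [hω] at e1
  rw [hρ] at e2
  rw [hσ] at e3
  have e1 : ω ^ 2 + ω + 1 = 0 := by
    apply mul_left_cancel₀ (pow_ne_zero 2 a0); linear_combination e1
  have e2 : ρ ^ 2 + ρ + 1 = 0 := by
    apply mul_left_cancel₀ (pow_ne_zero 2 b0); linear_combination e2
  have e3 : σ ^ 2 + σ + 1 = 0 := by
    apply mul_left_cancel₀ (pow_ne_zero 2 c0); linear_combination e3
  have hp : ω * ρ * σ = 1 := by linear_combination ω * ρ * σ * p1 - p2
  -- In characteristic 3 the only root is 1; distinctness of the new points excludes that case.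
  have hne : ¬ (ω = 1 ∧ ρ = 1) := by
    rintro ⟨rfl, rfl⟩
    exact hl (hinj (by rw [hω, one_mul]) (by rw [hρ, one_mul])).symm
  have f1 : ω = ρ := by grind
  have f2 : ω = σ := by grind
  exact ⟨ω, e1, hω, by rw [hρ, f1], by rw [hσ, f2]⟩

/-- No configuration with three doubly special points. -/
lemma not_cyclic (h : Balanced A B C a b c) {l l' s t r : Fin 5} (hl : l ≠ l')
    (la : a l ∉ A) (lb : b l ∉ B) (lc : c l ∉ C) (la' : a l' ∉ A) (lb' : b l' ∉ B) (lc' : c l' ∉ C)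
    (sa : a s ∈ A) (sb : b s ∈ B) (sc : c s ∉ C) (ta : a t ∉ A) (tb : b t ∈ B) (tc : c t ∈ C)
    (ra : a r ∈ A) (rb : b r ∉ B) (rc : c r ∈ C) : False := by
  have h' := h.rotate
  have h'' := h'.rotate
  have na : a s ≠ a r := fun e => rb (by rw [← h.unique ra e]; exact sb)
  have nb : b s ≠ b t := fun e => ta (by rw [← h'.unique tb e]; exact sa)
  have nc : c t ≠ c r := fun e => rb (by rw [← h''.unique rc e]; exact tb)
  obtain ⟨ω, hω, ea, eb, ec⟩ := h.ordinary_ratio hl la lb lc la' lb' lc'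
  -- The three ordinary parameters on a side sum to zero and two have ratio ω, so the third has
  -- ratio -1 - ω = ω².
  have ht : a t = ω ^ 2 * a l := by
    have := h.sum_eq_zero hl (k := t) (fun e => lb (e ▸ tb)) (fun e => lb' (e ▸ tb)) la la' ta
    linear_combination this - ea - a l * hω
  have hr : b r = ω ^ 2 * b l := by
    have := h'.sum_eq_zero hl (k := r) (fun e => la (e ▸ ra)) (fun e => la' (e ▸ ra)) lb lb' rb
    linear_combination this - eb - b l * hω
  have hs : c s = ω ^ 2 * c l := by
    have := h''.sum_eq_zero hl (k := s) (fun e => la (e ▸ sa)) (fun e => la' (e ▸ sa)) lc lc' sc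
    linear_combination this - ec - c l * hω
  obtain ⟨f1, f1'⟩ := h.cyclic_aux hω ht hr hs sa sb tb tc rc ra na nb nc sc
  obtain ⟨f2, -⟩ := h'.cyclic_aux hω hr hs ht tb tc rc ra sa sb nb.symm nc na.symm ta
  obtain ⟨f3, -⟩ := h''.cyclic_aux hω hs ht hr rc ra sa sb tb tc nc.symm na.symm nb rb
  have a0 := h.a_ne l
  have b0 := h'.a_ne l
  have c0 := h''.a_ne l
  have p0 := h.config.prod l
  have p1 := h.config.prod s
  have p3 := h.config.prod r
  have hcube := h.cube_ne sa la
  have hm : OnJoin (a l) (b l) (a s) (b s) ∨ OnJoin (a l) (b l) (a s) (b t) ∨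
      OnJoin (c l) (a l) (c t) (a s) ∨ OnJoin (c l) (a l) (c r) (a s) := by
    rcases h.meet sa l with e | ⟨β, hβ, e⟩ | ⟨γ, hγ, e⟩
    · exact absurd (e ▸ sa) la
    · rcases eq_or_eq_of_card_two h.cardB sb tb nb hβ with rfl | rfl
      · exact Or.inl e
      · exact Or.inr (Or.inl e)
    · rcases eq_or_eq_of_card_two h.cardC tc rc nc hγ with rfl | rfl
      · exact Or.inr (Or.inr (Or.inl e))
      · exact Or.inr (Or.inr (Or.inr e))
  obtain ⟨x, hx⟩ : ∃ x, a s = x * a l := ⟨a s / a l, by field_simp⟩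
  obtain ⟨x', hx'⟩ : ∃ x, a r = x * a l := ⟨a r / a l, by field_simp⟩
  obtain ⟨y, hy⟩ : ∃ x, b s = x * b l := ⟨b s / b l, by field_simp⟩
  obtain ⟨y', hy'⟩ : ∃ x, b t = x * b l := ⟨b t / b l, by field_simp⟩
  obtain ⟨z, hz⟩ : ∃ x, c t = x * c l := ⟨c t / c l, by field_simp⟩
  obtain ⟨z', hz'⟩ : ∃ x, c r = x * c l := ⟨c r / c l, by field_simp⟩
  rw [hx, hy, hs] at p1
  rw [hx', hr, hz'] at p3
  rw [hx', hy'] at f1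
  rw [hy, hz'] at f2
  rw [hz, hx] at f3
  rw [hx] at hcube
  unfold OnJoin at f1' hm
  rw [hs, hx, hz, hz', hx'] at f1'
  rw [hx, hy, hy', hz, hz'] at hm
  have g0 : x * y = ω := by
    linear_combination -ω * p1 + ω * x * y * ω ^ 2 * p0 + (1 - ω) * (x * y) * hω
  have g0' : z' * x' = ω := by
    linear_combination -ω * p3 + ω * z' * x' * ω ^ 2 * p0 + (1 - ω) * (z' * x') * hω
  have g1 : x' * y' = ω := mul_left_cancel₀ (mul_ne_zero a0 b0) (by linear_combination f1)
  have g2 : y * z' = ω := mul_left_cancel₀ (mul_ne_zero b0 c0) (by linear_combination f2)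
  have g3 : z * x = ω := mul_left_cancel₀ (mul_ne_zero c0 a0) (by linear_combination f3)
  have hω0 : ω ≠ 0 := by rintro rfl; simp at hω
  have x0 : x ≠ 0 := by rintro rfl; simp at g0; exact hω0 g0.symm
  have x0' : x' ≠ 0 := by rintro rfl; simp at g1; exact hω0 g1.symm
  have y0 : y ≠ 0 := by rintro rfl; simp at g0; exact hω0 g0.symm
  have i1 : z' = x := mul_left_cancel₀ y0 (by linear_combination g2 - g0)
  have i2 : y' = z' := mul_left_cancel₀ x0' (by linear_combination g1 - g0')
  have i3 : y = z := mul_left_cancel₀ x0 (by linear_combination g0 - g3)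
  have i4 : y = x' := mul_left_cancel₀ x0 (by rw [i1] at g0'; linear_combination g0 - g0')
  subst i1 i2 i3 i4
  refine cyclic_contradiction hω g0 (fun e => hcube (by linear_combination a l ^ 3 * e)) ?_ ?_
  · refine f1'.imp (fun e => ?_) (fun e => ?_)
    · exact mul_left_cancel₀ (mul_ne_zero c0 a0) (by linear_combination e)
    · exact mul_left_cancel₀ (mul_ne_zero c0 a0) (by linear_combination e - c l * a l * g0)
  · rcases hm with e | e | e | e
    · exact Or.inl (mul_left_cancel₀ (mul_ne_zero a0 b0)
        (by linear_combination e - a l * b l * g0))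
    · exact Or.inr (Or.inl (mul_left_cancel₀ (mul_ne_zero a0 b0) (by linear_combination e)))
    · exact Or.inr (Or.inr (mul_left_cancel₀ (mul_ne_zero a0 c0)
        (by linear_combination e - a l * c l * g0)))
    · exact Or.inr (Or.inl (mul_left_cancel₀ (mul_ne_zero a0 c0) (by linear_combination e)))

end TriangleConfig.Balanced

/-! ### Distribution of the special points -/

namespace TriangleConfig.Balanced

variable {A B C : Finset K} {a b c : Fin 5 → K}

lemma exists_special (h : Balanced A B C a b c) :
    ∃ p q, p ≠ q ∧ ∀ i, a i ∈ A ↔ i = p ∨ i = q := by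
  classical
  obtain ⟨p, q, hpq, hS⟩ := Finset.card_eq_two.1 h.card_special
  exact ⟨p, q, hpq, fun i => by simpa using Finset.ext_iff.1 hS i⟩

lemma exists_special_ne (h : Balanced A B C a b c) {s : Fin 5} (hs : a s ∈ A) :
    ∃ p, p ≠ s ∧ ∀ i, a i ∈ A ↔ i = p ∨ i = s := by
  obtain ⟨p, q, hpq, hS⟩ := h.exists_special
  rcases (hS s).1 hs with rfl | rfl
  · exact ⟨q, hpq.symm, fun i => by rw [hS, or_comm]⟩
  · exact ⟨p, hpq, hS⟩

/-- With s special for two sides, the remaining special positions p, q, r, r' must account for the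
other four new points. Hence all five indices are distinct and the pattern is the spread one. -/
lemma not_covered (h : Balanced A B C a b c) (hcov : ∀ i, a i ∈ A ∨ b i ∈ B ∨ c i ∈ C)
    {s : Fin 5} (sa : a s ∈ A) (sb : b s ∈ B) : False := by
  obtain ⟨p, hp, hP⟩ := h.exists_special_ne sa
  obtain ⟨q, hq, hQ⟩ := h.rotate.exists_special_ne sb
  obtain ⟨r, r', hr, hR⟩ := h.rotate.rotate.exists_special
  have hcov' : ∀ i, i = p ∨ i = q ∨ i = r ∨ i = r' ∨ i = s := fun i => by
    have := hcov i
    rw [hP, hQ, hR] at this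
    tauto
  have hnd : [p, q, r, r', s].Nodup := by
    have h1 : [p, q, r, r', s].toFinset = Finset.univ := by
      ext i
      simpa using hcov' i
    have h2 := congrArg Finset.card h1
    rw [← Multiset.coe_nodup, ← Multiset.toFinset_card_eq_card_iff_nodup]
    exact h2
  simp only [List.nodup_cons, List.mem_cons, List.not_mem_nil, or_false, not_or] at hnd
  obtain ⟨⟨-, n1, n2, n3⟩, ⟨n4, n5, n6⟩, ⟨n7, n8⟩, n9, -⟩ := hnd
  refine h.not_spread (p := p) (q := q) (r := r) (r' := r') (s := s) hp hq hr hcov' ?_ ?_ ?_ ?_ sa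
    sb ?_ ?_ ?_ ?_ ?_
  all_goals simp only [hP, hQ, hR]; tauto

/-- If two coordinates of i were ordinary, they would have the cubes of those of l. As both products
are -1, the third cubes would agree too, contradicting `cube_ne`. -/
lemma special_of_ordinary (h : Balanced A B C a b c) {l : Fin 5} (la : a l ∉ A) (lb : b l ∉ B)
    (lc : c l ∉ C) {i : Fin 5} (hi : c i ∈ C) : a i ∈ A ∨ b i ∈ B := by
  by_contra hn
  push Not at hn
  have e1 := h.cube_eq hn.1 la
  have e2 := h.rotate.cube_eq hn.2 lb
  refine h.rotate.rotate.cube_ne hi lc ?_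
  have h1 := h.config.prod i
  have h2 := h.config.prod l
  apply mul_left_cancel₀ (pow_ne_zero 3 (mul_ne_zero (h.a_ne l) (h.rotate.a_ne l)))
  have h3 : (a i * b i * c i) ^ 3 = (a l * b l * c l) ^ 3 := by rw [h1, h2]
  linear_combination h3 - b i ^ 3 * c i ^ 3 * e1 - a l ^ 3 * c i ^ 3 * e2

/-- No point is special for exactly one side, so the six special incidences form either two triples
or three pairs. In the latter case the fifth point is ordinary as well. -/
lemma not_ordinary_aux (h : Balanced A B C a b c) {l : Fin 5} (la : a l ∉ A) (lb : b l ∉ B)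
    (lc : c l ∉ C) {s : Fin 5} (sa : a s ∈ A) (sb : b s ∈ B) : False := by
  have kc := fun i => h.special_of_ordinary la lb lc (i := i)
  have ka := fun i => h.rotate.special_of_ordinary lb lc la (i := i)
  have kb := fun i => h.rotate.rotate.special_of_ordinary lc la lb (i := i)
  obtain ⟨p, hp, hP⟩ := h.exists_special_ne sa
  obtain ⟨q, hq, hQ⟩ := h.rotate.exists_special_ne sb
  obtain ⟨r, r', hr, hR⟩ := h.rotate.rotate.exists_special
  by_cases hpq : p = q
  · subst hpq
    have h1 := kc r ((hR r).2 (Or.inl rfl))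
    have h2 := kc r' ((hR r').2 (Or.inr rfl))
    rw [hP, hQ, or_self] at h1 h2
    have h3 : ∀ i, i = p ∨ i = s → c i ∈ C := fun i hi => by rw [hR]; grind
    exact h.not_doubled hp.symm sa sb (h3 s (by simp)) ((hP p).2 (by simp)) ((hQ p).2 (by simp))
      (h3 p (by simp)) (fun i h1 h2 => by rw [hP]; tauto)
  · have pc : c p ∈ C := by
      have := ka p ((hP p).2 (by simp))
      rw [hQ] at this
      tauto
    have qc : c q ∈ C := by
      have := kb q ((hQ q).2 (by simp))
      rw [hP] at this
      tauto
    have sc : c s ∉ C := by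
      rw [hR] at pc qc ⊢
      grind
    have hl : ∃ l', l' ≠ l ∧ l' ≠ s ∧ l' ≠ p ∧ l' ≠ q := by
      have : (({l, s, p, q} : Finset (Fin 5))ᶜ).Nonempty := by
        rw [← Finset.card_pos, Finset.card_compl]
        have := Finset.card_le_four (a := l) (b := s) (c := p) (d := q)
        simp
        omega
      obtain ⟨l', hl'⟩ := this
      exact ⟨l', by simpa using hl'⟩
    obtain ⟨l', h0, h1, h2, h3⟩ := hl
    have la' : a l' ∉ A := by rw [hP]; tauto
    have lb' : b l' ∉ B := by rw [hQ]; tauto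
    have lc' : c l' ∉ C := fun e => (kc l' e).elim la' lb'
    refine h.not_cyclic (l := l) (l' := l') (s := s) (t := q) (r := p) h0.symm la lb lc la' lb' lc'
      sa sb sc ?_ ?_ qc ?_ ?_ pc
    all_goals simp only [hP, hQ]; tauto

lemma not_ordinary (h : Balanced A B C a b c) {l : Fin 5} (la : a l ∉ A) (lb : b l ∉ B)
    (lc : c l ∉ C) : False := by
  obtain ⟨p, q, -, hP⟩ := h.exists_special
  have pa := (hP p).2 (by simp)
  rcases h.rotate.special_of_ordinary lb lc la pa with hb | hc
  · exact h.not_ordinary_aux la lb lc pa hb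
  · exact h.rotate.rotate.not_ordinary_aux lc la lb hc pa

theorem false (h : Balanced A B C a b c) : False := by
  classical
  by_cases hcov : ∀ i, a i ∈ A ∨ b i ∈ B ∨ c i ∈ C
  · by_cases h1 : ∃ s, a s ∈ A ∧ b s ∈ B
    · exact h.not_covered hcov h1.choose_spec.1 h1.choose_spec.2
    by_cases h2 : ∃ s, b s ∈ B ∧ c s ∈ C
    · exact h.rotate.not_covered (fun i => by have := hcov i; tauto) h2.choose_spec.1
        h2.choose_spec.2
    by_cases h3 : ∃ s, c s ∈ C ∧ a s ∈ A
    · exact h.rotate.rotate.not_covered (fun i => by have := hcov i; tauto) h3.choose_spec.1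
        h3.choose_spec.2
    push Not at h1 h2 h3
    have e1 := h.card_special
    have e2 := h.rotate.card_special
    have e3 := h.rotate.rotate.card_special
    have d1 : Disjoint (Finset.univ.filter (fun i => a i ∈ A))
        (Finset.univ.filter (fun i => b i ∈ B)) :=
      Finset.disjoint_filter.2 fun i _ => h1 i
    have d2 : Disjoint (Finset.univ.filter (fun i => a i ∈ A) ∪
        Finset.univ.filter (fun i => b i ∈ B)) (Finset.univ.filter (fun i => c i ∈ C)) :=
      Finset.disjoint_union_left.2 ⟨Finset.disjoint_filter.2 fun i _ hi hj => h3 i hj hi,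
        Finset.disjoint_filter.2 fun i _ => h2 i⟩
    have := Finset.card_le_univ ((Finset.univ.filter (fun i => a i ∈ A) ∪
        Finset.univ.filter (fun i => b i ∈ B)) ∪ (Finset.univ.filter (fun i => c i ∈ C)))
    rw [Finset.card_union_of_disjoint d2, Finset.card_union_of_disjoint d1, e1, e2, e3] at this
    simp at this
  · push Not at hcov
    obtain ⟨l, la, lb, lc⟩ := hcov
    exact h.not_ordinary la lb lc

end TriangleConfig.Balanced

/-! ### Covering a punctured grid by lines -/

section GridCover

open MvPolynomial

/-- The exponent of the monomial `X₀ᵐ X₁ⁿ`. -/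
noncomputable def bidegree (m n : ℕ) : Fin 2 →₀ ℕ := Finsupp.single 0 m + Finsupp.single 1 n

lemma bidegree_apply_zero (m n : ℕ) : bidegree m n 0 = m := by simp [bidegree]

lemma bidegree_apply_one (m n : ℕ) : bidegree m n 1 = n := by simp [bidegree]

lemma degree_bidegree (m n : ℕ) : (bidegree m n).degree = m + n := by
  simp [bidegree]

lemma coeff_bidegree_pow_mul_pow (m n i j : ℕ) :
    coeff (bidegree m n) (X 0 ^ i * X 1 ^ j : MvPolynomial (Fin 2) K) =
      if i = m ∧ j = n then 1 else 0 := by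
  have h1 : (X 0 ^ i * X 1 ^ j : MvPolynomial (Fin 2) K) = monomial (bidegree i j) 1 := by
    rw [X_pow_eq_monomial, X_pow_eq_monomial, monomial_mul, one_mul, bidegree]
  rw [h1, coeff_monomial]
  congr 1
  apply propext
  constructor
  · intro h
    have h0 := DFunLike.congr_fun h 0
    have h1 := DFunLike.congr_fun h 1
    rw [bidegree_apply_zero, bidegree_apply_zero] at h0
    rw [bidegree_apply_one, bidegree_apply_one] at h1
    exact ⟨h0, h1⟩
  · rintro ⟨rfl, rfl⟩; rfl

lemma prod_X_sub_C_eq (A : Finset K) (k : Fin 2) :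
    ∏ x ∈ A, (X k - C x : MvPolynomial (Fin 2) K) =
      ∑ i ∈ Finset.range (A.card + 1), C ((∏ x ∈ A, (Polynomial.X - Polynomial.C x)).coeff i) *
        X k ^ i := by
  have h1 : ∏ x ∈ A, (X k - C x : MvPolynomial (Fin 2) K) =
      Polynomial.aeval (X k) (∏ x ∈ A, (Polynomial.X - Polynomial.C x)) := by
    rw [map_prod]
    simp [MvPolynomial.algebraMap_eq]
  rw [h1, Polynomial.aeval_eq_sum_range, Polynomial.natDegree_prod_of_monic _ _
    (fun x _ => Polynomial.monic_X_sub_C x)]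
  simp [MvPolynomial.smul_eq_C_mul]

lemma coeff_prod_mul_prod (A B : Finset K) :
    coeff (bidegree A.card B.card) ((∏ x ∈ A, (X 0 - C x : MvPolynomial (Fin 2) K)) *
      ∏ y ∈ B, (X 1 - C y)) = 1 := by
  have hm : ∀ A : Finset K, (∏ x ∈ A, (Polynomial.X - Polynomial.C x)).coeff A.card = 1 := by
    intro A
    have h1 := Polynomial.monic_prod_of_monic A (fun x => Polynomial.X - Polynomial.C x)
      (fun x _ => Polynomial.monic_X_sub_C x)
    have h2 := h1.coeff_natDegree
    rwa [Polynomial.natDegree_prod_of_monic _ _ (fun x _ => Polynomial.monic_X_sub_C x),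
      Finset.sum_congr rfl (fun x _ => Polynomial.natDegree_X_sub_C x), Finset.sum_const,
      smul_eq_mul, mul_one] at h2
  rw [prod_X_sub_C_eq, prod_X_sub_C_eq, Finset.sum_mul_sum, coeff_sum,
    Finset.sum_eq_single A.card, coeff_sum, Finset.sum_eq_single B.card, hm, hm]
  · simp [coeff_bidegree_pow_mul_pow]
  · intro j _ hj
    rw [mul_mul_mul_comm, ← C_mul, coeff_C_mul, coeff_bidegree_pow_mul_pow, if_neg (by tauto),
      mul_zero]
  · simp
  · intro i _ hi
    rw [coeff_sum]
    refine Finset.sum_eq_zero fun j _ => ?_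
    rw [mul_mul_mul_comm, ← C_mul, coeff_C_mul, coeff_bidegree_pow_mul_pow, if_neg (by tauto),
      mul_zero]
  · simp

lemma totalDegree_prod_le {ι : Type*} (s : Finset ι) (f : ι → MvPolynomial (Fin 2) K)
    (hf : ∀ i ∈ s, (f i).totalDegree ≤ 1) : (∏ i ∈ s, f i).totalDegree ≤ s.card := by
  refine (totalDegree_finsetProd _ _).trans ?_
  simpa using Finset.sum_le_card_nsmul s _ 1 hf

lemma totalDegree_X_sub_C_le (k : Fin 2) (x : K) :
    (X k - C x : MvPolynomial (Fin 2) K).totalDegree ≤ 1 := by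
  refine (totalDegree_sub _ _).trans ?_
  simp

lemma totalDegree_linear_le (p r : K) :
    (C p * X 0 + C r * X 1 : MvPolynomial (Fin 2) K).totalDegree ≤ 1 := by
  refine (totalDegree_add _ _).trans (max_le ?_ ?_) <;>
  · refine (totalDegree_mul _ _).trans ?_
    simp

/-- Choosing a -1 from any factor lowers the degree below that of d. -/
lemma coeff_prod_sub_one {ι : Type*} [Fintype ι] (f : ι → MvPolynomial (Fin 2) K)
    (hf : ∀ i, (f i).totalDegree ≤ 1) (d : Fin 2 →₀ ℕ) (hd : Fintype.card ι ≤ d.degree) :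
    coeff d (∏ i, (f i - 1)) = coeff d (∏ i, f i) := by
  classical
  simp_rw [sub_eq_add_neg]
  rw [Finset.prod_add, coeff_sum, Finset.sum_eq_single Finset.univ]
  · simp
  · intro t _ ht
    have h1 : (∏ i ∈ Finset.univ \ t, (-1 : MvPolynomial (Fin 2) K)) =
        C ((-1) ^ (Finset.univ \ t).card) := by simp
    rw [h1, mul_comm, coeff_C_mul, coeff_eq_zero_of_totalDegree_lt, mul_zero]
    rw [← Finsupp.degree_apply]
    refine lt_of_le_of_lt (totalDegree_prod_le t f fun i _ => hf i) (lt_of_lt_of_le ?_ hd)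
    exact Finset.card_lt_univ_of_notMem
      (by simpa [Finset.eq_univ_iff_forall] using ht : ∃ x, x ∉ t).choose_spec
  · simp

/-- A punctured grid cannot be covered by too few lines that avoid the origin. -/
theorem not_grid_cover {ι : Type*} [Fintype ι] {A B : Finset K} (hA : 0 ∉ A) (hB : 0 ∉ B)
    (p r : ι → K)
    (hcov : ∀ x y, x = 0 ∨ x ∈ A → y = 0 ∨ y ∈ B → x ≠ 0 ∨ y ≠ 0 → ∃ i, p i * x + r i * y = 1)
    (hcard : Fintype.card ι ≤ A.card + B.card)
    (hcoeff : coeff (bidegree A.card B.card)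
      (∏ i, (C (p i) * X 0 + C (r i) * X 1 : MvPolynomial (Fin 2) K)) = 0) : False := by
  classical
  set F : MvPolynomial (Fin 2) K := ∏ i, ((C (p i) * X 0 + C (r i) * X 1) - 1) with hF
  set G : MvPolynomial (Fin 2) K := (∏ x ∈ A, (X 0 - C x)) * ∏ y ∈ B, (X 1 - C y) with hG
  have hFe : ∀ s : Fin 2 → K, eval s F = ∏ i, (p i * s 0 + r i * s 1 - 1) := by
    intro s; simp [hF]
  have hGe : ∀ s : Fin 2 → K, eval s G = (∏ x ∈ A, (s 0 - x)) * ∏ y ∈ B, (s 1 - y) := by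
    intro s; simp [hG]
  have hF0 : eval 0 F ≠ 0 := by
    rw [hFe]
    simp
  have hG0 : eval 0 G ≠ 0 := by
    rw [hGe]
    refine mul_ne_zero (Finset.prod_ne_zero_iff.2 fun x hx => ?_)
      (Finset.prod_ne_zero_iff.2 fun x hx => ?_)
    · simpa using fun e : x = 0 => hA (e ▸ hx)
    · simpa using fun e : x = 0 => hB (e ▸ hx)
  -- This scaling makes F - k·G vanish at the origin as well, hence on the whole grid, while its
  -- coefficient at the top bidegree is -k.
  set k := eval 0 F / eval 0 G with hk
  have hk0 : k ≠ 0 := div_ne_zero hF0 hG0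
  have hFd : F.totalDegree ≤ A.card + B.card := by
    refine le_trans (totalDegree_prod_le _ _ fun i _ => ?_) hcard
    exact (totalDegree_sub _ _).trans (max_le (totalDegree_linear_le _ _) (by simp))
  have hGd : G.totalDegree ≤ A.card + B.card :=
    (totalDegree_mul _ _).trans (add_le_add
      (totalDegree_prod_le _ _ fun i _ => totalDegree_X_sub_C_le _ _)
      (totalDegree_prod_le _ _ fun i _ => totalDegree_X_sub_C_le _ _))
  have hc : coeff (bidegree A.card B.card) (F - C k * G) ≠ 0 := by
    rw [coeff_sub, coeff_C_mul, coeff_prod_mul_prod, hF,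
      coeff_prod_sub_one _ (fun i => totalDegree_linear_le _ _) _ (by rwa [degree_bidegree]),
      hcoeff]
    simpa using hk0
  have ht : (F - C k * G).totalDegree = (bidegree A.card B.card).degree := by
    refine le_antisymm ?_ ?_
    · rw [degree_bidegree]
      refine (totalDegree_sub _ _).trans (max_le hFd ?_)
      refine (totalDegree_mul _ _).trans ?_
      simpa using hGd
    · exact le_totalDegree (mem_support_iff.2 hc)
  obtain ⟨s, hs, hne⟩ := combinatorial_nullstellensatz_exists_eval_nonzero (F - C k * G)
    (bidegree A.card B.card) hc ht ![insert 0 A, insert 0 B] (by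
      intro i
      fin_cases i
      · simp [bidegree_apply_zero, Finset.card_insert_of_notMem hA]
      · simp [bidegree_apply_one, Finset.card_insert_of_notMem hB])
  have h0 : s 0 = 0 ∨ s 0 ∈ A := by simpa using hs 0
  have h1 : s 1 = 0 ∨ s 1 ∈ B := by simpa using hs 1
  apply hne
  rw [map_sub, map_mul, eval_C]
  by_cases hz : s 0 ≠ 0 ∨ s 1 ≠ 0
  · have e1 : eval s F = 0 := by
      obtain ⟨i, hi⟩ := hcov _ _ h0 h1 hz
      rw [hFe]
      exact Finset.prod_eq_zero (Finset.mem_univ i) (by rw [hi, sub_self])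
    have e2 : eval s G = 0 := by
      rw [hGe]
      rcases hz with hz | hz
      · rw [Finset.prod_eq_zero (h0.resolve_left hz) (sub_self _), zero_mul]
      · rw [Finset.prod_eq_zero (h1.resolve_left hz) (sub_self _), mul_zero]
    rw [e1, e2, mul_zero, sub_zero]
  · push Not at hz
    have : s = 0 := by
      ext i
      fin_cases i
      · exact hz.1
      · exact hz.2
    rw [this, hk, div_mul_cancel₀ _ hG0, sub_self]

end GridCover

/-! ### Grid bounds and the case of no removed vertex -/

namespace TriangleConfig

variable {A B C : Finset K} {u v w : ℕ} {a b c : Fin 5 → K}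
open MvPolynomial

lemma exists_of_one_le {p : Fin 5 → Prop} [DecidablePred p]
    (h : 1 ≤ (Finset.univ.filter p).card) : ∃ i, p i := by
  obtain ⟨i, hi⟩ := Finset.card_pos.1 h
  exact ⟨i, by simpa using hi⟩

open Classical in
/-- The grid formed by the removed points on two sides is covered by the new points. -/
lemma coeff_ne_zero (h : TriangleConfig A B C u v w a b c) (hc : 5 ≤ A.card + B.card) :
    coeff (bidegree A.card B.card)
      (∏ i, (MvPolynomial.C (a i)⁻¹ * X 0 + MvPolynomial.C (b i) * X 1 :
        MvPolynomial (Fin 2) K)) ≠ 0 := by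
  have hB : (B.map ⟨_, inv_injective⟩).card = B.card := Finset.card_map _
  intro hz
  -- In the coordinates x = α, y = β⁻¹, incidence with a new point reads x/a + by = 1. The grid axes
  -- correspond to lines through a vertex.
  refine not_grid_cover (ι := Fin 5) (A := A) (B := B.map ⟨_, inv_injective⟩) h.zeroA
    (by simpa using h.zeroB) (fun i => (a i)⁻¹) b ?_ (by simpa [hB] using hc) (by rwa [hB])
  intro x y hx hy hne
  have hy' : y = 0 ∨ y⁻¹ ∈ B := by
    refine hy.imp_right fun hy => ?_
    obtain ⟨z, hz, rfl⟩ := Finset.mem_map.1 hy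
    simpa using hz
  by_cases hx0 : x = 0
  · have hy0 : y ≠ 0 := hne.resolve_left (fun e => e hx0)
    have h1 := h.vertB y⁻¹ (inv_ne_zero hy0)
    rw [if_pos (hy'.resolve_left hy0)] at h1
    obtain ⟨i, hi⟩ := exists_of_one_le (le_trans (by omega) h1)
    exact ⟨i, by rw [hi, hx0, inv_mul_cancel₀ hy0, mul_zero, zero_add]⟩
  · have hxA := hx.resolve_left hx0
    by_cases hy0 : y = 0
    · have h1 := h.vertA x hx0
      rw [if_pos hxA] at h1
      obtain ⟨i, hi⟩ := exists_of_one_le (le_trans (by omega) h1)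
      exact ⟨i, by rw [hi, hy0, inv_mul_cancel₀ hx0, mul_zero, add_zero]⟩
    · have h1 := h.join x y⁻¹ (y / x) (by field_simp)
      rw [if_pos hxA, if_pos (hy'.resolve_left hy0)] at h1
      obtain ⟨i, hi⟩ := exists_of_one_le (p := fun i => OnJoin (a i) (b i) x y⁻¹) (by omega)
      refine ⟨i, ?_⟩
      have := h.a_ne i
      unfold OnJoin at hi
      field_simp at hi ⊢
      linear_combination hi

lemma card_add_card_le (h : TriangleConfig A B C u v w a b c) : A.card + B.card ≤ 5 := by
  by_contra hlt
  refine h.coeff_ne_zero (by omega) ?_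
  apply coeff_eq_zero_of_totalDegree_lt
  rw [← Finsupp.degree_apply, degree_bidegree]
  have := totalDegree_prod_le Finset.univ
    (fun i => (MvPolynomial.C (a i)⁻¹ * X 0 + MvPolynomial.C (b i) * X 1 :
        MvPolynomial (Fin 2) K)) (fun i _ => totalDegree_linear_le _ _)
  simp at this
  omega

/-- The grid bound makes each side lose a point; then each pair of sides loses at most four, and a
total of at least six forces 2 + 2 + 2. -/
lemma not_of_no_vertex (h : TriangleConfig A B C 0 0 0 a b c) : False := by
  have h1 := h.card_add_card_le
  have h2 := h.rotate.card_add_card_le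
  have h3 := h.rotate.rotate.card_add_card_le
  have ht := h.total
  obtain ⟨α, hα⟩ : A.Nonempty := Finset.card_pos.1 (by omega)
  obtain ⟨β, hβ⟩ : B.Nonempty := Finset.card_pos.1 (by omega)
  obtain ⟨γ, hγ⟩ : C.Nonempty := Finset.card_pos.1 (by omega)
  have k1 := h.card_le_of_mem hα
  have k2 := h.rotate.card_le_of_mem hβ
  have k3 := h.rotate.rotate.card_le_of_mem hγ
  exact Balanced.false ⟨h, by omega, by omega, by omega⟩

end TriangleConfig

/-! ### Removed vertices and the field of order five -/

section CardFive

variable [Fintype K]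

lemma five_eq_zero (h5 : Fintype.card K = 5) : (5 : K) = 0 := by
  have := Nat.cast_card_eq_zero K
  rw [h5] at this
  exact_mod_cast this

lemma two_ne_zero_of_card (h5 : Fintype.card K = 5) : (2 : K) ≠ 0 := by
  intro h
  exact one_ne_zero (α := K) (by linear_combination five_eq_zero h5 - 2 * h)

lemma three_ne_zero_of_card (h5 : Fintype.card K = 5) : (3 : K) ≠ 0 := by
  intro h
  exact one_ne_zero (α := K) (by linear_combination 2 * h - five_eq_zero h5)

lemma univ_erase_zero_val [DecidableEq K] (h5 : Fintype.card K = 5) :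
    (Finset.univ.erase 0 : Finset K).val = {1, -1, 2, -2} := by
  have h50 := five_eq_zero h5
  have h1 := one_ne_zero (α := K)
  have h2 := two_ne_zero_of_card h5
  have h3 := three_ne_zero_of_card h5
  have hnd : ({1, -1, 2, -2} : Multiset K).Nodup := by
    simp only [Multiset.insert_eq_cons, Multiset.nodup_cons, Multiset.mem_cons,
      Multiset.mem_singleton, not_or, Multiset.nodup_singleton, and_true]
    exact ⟨⟨fun e => h2 (by linear_combination e), fun e => h1 (by linear_combination -e),
      fun e => h3 (by linear_combination e)⟩, ⟨fun e => h3 (by linear_combination -e),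
      fun e => h1 (by linear_combination e)⟩, fun e => h2 (by linear_combination 3 * e - 2 * h50)⟩
  have hs : (⟨{1, -1, 2, -2}, hnd⟩ : Finset K) = Finset.univ.erase 0 := by
    apply Finset.eq_of_subset_of_card_le
    · intro x hx
      have hx : x ∈ ({1, -1, 2, -2} : Multiset K) := hx
      simp only [Multiset.insert_eq_cons, Multiset.mem_cons, Multiset.mem_singleton] at hx
      rw [Finset.mem_erase]
      rcases hx with rfl | rfl | rfl | rfl <;> simp [h2]
    · rw [Finset.card_erase_of_mem (Finset.mem_univ _), Finset.card_univ, h5]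
      rfl
  rw [← hs]

end CardFive

namespace TriangleConfig

variable {A B C : Finset K} {u v w : ℕ} {a b c : Fin 5 → K}

-- Each line through a removed vertex meeting the opposite side at a nonzero parameter needs a new
-- point, and a second one if that side point is removed.
open Classical in
lemma vertex_le [Fintype K] (h : TriangleConfig A B C u v w a b c) (hu : 1 ≤ u) :
    (Finset.univ.erase 0).val + A.val ≤ (Finset.univ : Finset (Fin 5)).val.map a := by
  rw [Multiset.le_iff_count]
  intro x
  rw [Multiset.count_add, Multiset.count_eq_of_nodup (Finset.nodup _),
    Multiset.count_eq_of_nodup (Finset.nodup _), Multiset.count_map]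
  by_cases hx : x = 0
  · subst hx
    simp only [Finset.mem_val, Finset.notMem_erase, h.zeroA, if_false]
    exact Nat.zero_le _
  · have h1 := h.vertA x hx
    have h2 : (Multiset.filter (fun i => x = a i) (Finset.univ : Finset (Fin 5)).val).card =
        (Finset.univ.filter fun i => a i = x).card := by
      simp only [eq_comm (a := x)]
      rfl
    rw [h2]
    simp only [Finset.mem_val, Finset.mem_erase, Finset.mem_univ, and_true, ne_eq, hx,
      not_false_eq_true, if_true]
    omega

lemma card_le_of_vertex [Fintype K] (h : TriangleConfig A B C u v w a b c) (hu : 1 ≤ u) :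
    Fintype.card K - 1 + A.card ≤ 5 := by
  classical
  simpa [Finset.card_erase_of_mem] using Multiset.card_le_card (h.vertex_le hu)

section CardFive

variable [Fintype K]

lemma vertex_eq (h5 : Fintype.card K = 5) (h : TriangleConfig A B C u v w a b c)
    (hu : 1 ≤ u) {α : K} (hA : A = {α}) :
    (Finset.univ : Finset (Fin 5)).val.map a = {1, -1, 2, -2, α} := by
  classical
  symm
  have h1 := h.vertex_le hu
  rw [univ_erase_zero_val h5, hA] at h1
  exact Multiset.eq_of_le_of_card_le h1 (by simp)

/-- The a's are all nonzero elements together with α; the nonzero elements have sum 0, sum of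
inverses 0 and product -1. -/
lemma sums_of_vertex (h5 : Fintype.card K = 5) (h : TriangleConfig A B C u v w a b c)
    (hu : 1 ≤ u) {α : K} (hA : A = {α}) :
    ∑ i, a i = α ∧ ∑ i, (a i)⁻¹ = α⁻¹ ∧ ∏ i, a i = -α := by
  have h1 := h.vertex_eq h5 hu hA
  refine ⟨?_, ?_, ?_⟩
  · refine (congrArg Multiset.sum h1).trans ?_
    simp only [Multiset.insert_eq_cons, Multiset.sum_cons, Multiset.sum_singleton]
    ring
  · have h2 : ((Finset.univ : Finset (Fin 5)).val.map fun i => (a i)⁻¹) =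
        ({1, -1, 2, -2, α} : Multiset K).map (·⁻¹) := by rw [← h1, Multiset.map_map]; rfl
    refine (congrArg Multiset.sum h2).trans ?_
    simp only [Multiset.insert_eq_cons, Multiset.map_cons, Multiset.map_singleton,
      Multiset.sum_cons, Multiset.sum_singleton, inv_neg]
    ring
  · refine (congrArg Multiset.prod h1).trans ?_
    simp only [Multiset.insert_eq_cons, Multiset.prod_cons, Multiset.prod_singleton]
    linear_combination α * five_eq_zero h5

-- The c's run over all nonzero elements and one extra m, so the product of linear forms is a
-- multiple of (Y⁴ - X⁴)(Y - mX). Its X²Y³ and X³Y² coefficients vanish, contradicting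
-- `coeff_ne_zero`.
open MvPolynomial in
lemma not_of_one_vertex (h5 : Fintype.card K = 5) (h : TriangleConfig A B C u v w a b c)
    (hw : 1 ≤ w) (hAB : A.card = 2 ∧ B.card = 3 ∨ A.card = 3 ∧ B.card = 2) : False := by
  classical
  refine h.coeff_ne_zero (by omega) ?_
  have h1 : ({1, -1, 2, -2} : Multiset K) ≤ (Finset.univ : Finset (Fin 5)).val.map c := by
    rw [← univ_erase_zero_val h5]
    exact (Multiset.le_add_right _ _).trans (h.rotate.rotate.vertex_le hw)
  obtain ⟨t, ht⟩ := Multiset.le_iff_exists_add.1 h1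
  have htc : t.card = 1 := by
    have := congrArg Multiset.card ht
    simp at this
    omega
  obtain ⟨m, rfl⟩ := Multiset.card_eq_one.1 htc
  have h2 : ∏ i, (MvPolynomial.C (a i)⁻¹ * X 0 + MvPolynomial.C (b i) * X 1 :
        MvPolynomial (Fin 2) K) =
      (∏ i, MvPolynomial.C (b i)) * ∏ i, (X 1 - MvPolynomial.C (c i) * X 0) := by
    rw [← Finset.prod_mul_distrib]
    refine Finset.prod_congr rfl fun i _ => ?_
    have ha := h.a_ne i
    have : (a i)⁻¹ = -(b i * c i) := by
      field_simp
      linear_combination h.prod i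
    rw [this, map_neg, map_mul]
    ring
  have h3 : ∏ i, (X 1 - MvPolynomial.C (c i) * X 0 : MvPolynomial (Fin 2) K) =
      (({1, -1, 2, -2} + {m} : Multiset K).map fun x =>
        (X 1 - MvPolynomial.C x * X 0 : MvPolynomial (Fin 2) K)).prod := by
    rw [← ht, Multiset.map_map]; rfl
  have h50 : (5 : MvPolynomial (Fin 2) K) = 0 := by
    rw [← map_ofNat (MvPolynomial.C (R := K)) 5, five_eq_zero h5, map_zero]
  have h4 : ∏ i, (X 1 - MvPolynomial.C (c i) * X 0 : MvPolynomial (Fin 2) K) =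
      X 0 ^ 0 * X 1 ^ 5 - MvPolynomial.C m * (X 0 ^ 1 * X 1 ^ 4) - X 0 ^ 4 * X 1 ^ 1 +
        MvPolynomial.C m * (X 0 ^ 5 * X 1 ^ 0) := by
    rw [h3]
    simp only [Multiset.insert_eq_cons, Multiset.map_add, Multiset.prod_add, Multiset.map_cons,
      Multiset.map_singleton, Multiset.prod_cons, Multiset.prod_singleton, map_neg, map_one,
      map_ofNat]
    linear_combination (X 0 ^ 2 * X 1 ^ 2 * 0 + (X 0 ^ 4 - X 0 ^ 2 * X 1 ^ 2) *
      (X 1 - MvPolynomial.C m * X 0)) * h50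
  rw [h2, h4, ← map_prod, coeff_C_mul]
  simp only [coeff_add, coeff_sub, coeff_C_mul, coeff_bidegree_pow_mul_pow]
  rcases hAB with ⟨e1, e2⟩ | ⟨e1, e2⟩ <;> simp [e1, e2]

lemma no_cube_root (h5 : Fintype.card K = 5) {x y : K} (hy : y ≠ 0)
    (h : x ^ 2 + x * y + y ^ 2 = 0) : False := by
  have h1 : (x / y) ^ 2 + x / y + 1 = 0 := by
    field_simp
    linear_combination h
  have h2 : x / y ≠ 0 := by
    intro e
    rw [e] at h1
    simp at h1
  have h3 := FiniteField.pow_card_sub_one_eq_one (x / y) h2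
  rw [h5] at h3
  have h4 : x / y = 1 := by linear_combination h3 - ((x / y) ^ 2 - x / y) * h1
  rw [h4] at h1
  exact three_ne_zero_of_card h5 (by linear_combination h1)

/-- Tight pencils through α and β determine the sums of the c's and of their inverses. Beyond γ, γ'
three c's with e₁ = e₂ = 0 remain, whose ratios would be roots of X² + X + 1, impossible in order
five. -/
lemma not_of_two_vertices (h5 : Fintype.card K = 5) (h : TriangleConfig A B C 1 1 w a b c)
    (hA : A.card = 1) (hB : B.card = 1) (hC : C.card = 2) : False := by
  classical
  obtain ⟨α, rfl⟩ := Finset.card_eq_one.1 hA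
  obtain ⟨β, rfl⟩ := Finset.card_eq_one.1 hB
  obtain ⟨γ, γ', hne, rfl⟩ := Finset.card_eq_two.1 hC
  have α0 : α ≠ 0 := fun e => h.zeroA (by simp [e])
  have β0 : β ≠ 0 := fun e => h.zeroB (by simp [e])
  have γ0 : γ ≠ 0 := fun e => h.zeroC (by simp [e])
  have γ0' : γ' ≠ 0 := fun e => h.zeroC (by simp [e])
  have s1 := h.pencil_sum (α := α) (by simp) (by rw [hB, hC])
  have s2 := h.rotate.pencil_sum (α := β) (by simp) (by rw [hA, hC])
  obtain ⟨a1, -, -⟩ := h.sums_of_vertex h5 le_rfl rfl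
  obtain ⟨-, b2, -⟩ := h.rotate.sums_of_vertex h5 le_rfl rfl
  rw [Finset.sum_singleton, Finset.sum_pair hne, b2] at s1
  rw [Finset.sum_singleton, Finset.sum_pair hne, a1] at s2
  have t1 : ∑ i, c i = γ + γ' := mul_left_cancel₀ α0 (by linear_combination -s1)
  have t2 : ∑ i, (c i)⁻¹ = γ⁻¹ + γ'⁻¹ := by linear_combination -s2
  have v1 := h.vertC γ γ0
  have v2 := h.vertC γ' γ0'
  rw [if_pos (by simp)] at v1 v2
  obtain ⟨p, rfl⟩ := exists_of_one_le (le_trans (by omega) v1)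
  obtain ⟨q, rfl⟩ := exists_of_one_le (le_trans (by omega) v2)
  have hpq : p ≠ q := fun e => hne (by rw [e])
  have hcard : ((Finset.univ.erase p).erase q).card = 3 := by
    rw [Finset.card_erase_of_mem (by simp [hpq.symm]), Finset.card_erase_of_mem (by simp)]
    rfl
  obtain ⟨i, j, k, hij, hik, hjk, hS⟩ := Finset.card_eq_three.1 hcard
  have hf : ∀ f : K → K, ∑ i, f (c i) = f (c p) + f (c q) →
      f (c i) + f (c j) + f (c k) = 0 := by
    intro f hf
    rw [← Finset.add_sum_erase _ _ (Finset.mem_univ p), ← Finset.add_sum_erase _ _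
      (show q ∈ Finset.univ.erase p by simp [hpq.symm]), hS,
      Finset.sum_insert (by simp [hij, hik]), Finset.sum_insert (by simp [hjk]),
      Finset.sum_singleton] at hf
    linear_combination hf
  have f1 := hf id t1
  have f2 := hf (·⁻¹) t2
  have hi := h.c_ne i
  have hj := h.c_ne j
  have hk := h.c_ne k
  simp only [id] at f1
  field_simp at f2
  exact no_cube_root h5 (x := c i) hj (by linear_combination (c i + c j) * f1 - f2)

-- Division by α, β, γ reduces this to a finite check over `ZMod 5`. The weights are chosen to
-- contradict the global counts once summed over five new points.
open Classical in
lemma weight_le (h5 : Fintype.card K = 5) {a b c α β γ : K} (hα : α ≠ 0)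
    (hβ : β ≠ 0) (hγ : γ ≠ 0) (h : a * b * c = -1) (hl : α * β * γ = 1) :
    6 * (if OnJoin a b α β then 1 else 0) + 3 * ((if a = α then 1 else 0) + (if b = β then 1 else 0)
      + (if c = γ then 1 else 0)) ≤ 3 + 3 * ((if a = -α then 1 else 0) + (if b = -β then 1 else 0)
      + (if c = -γ then 1 else 0)) := by
  have key : ∀ p q r : ZMod 5, p * q * r = -1 → 6 * (if 1 + p * q = p then 1 else 0) +
      3 * ((if p = 1 then 1 else 0) + (if q = 1 then 1 else 0) + (if r = 1 then 1 else 0)) ≤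
      3 + 3 * ((if p = -1 then 1 else 0) + (if q = -1 then 1 else 0)
      + (if r = -1 then 1 else 0)) := by decide
  have e : K ≃+* ZMod 5 := (ZMod.ringEquivOfPrime K (by norm_num) h5).symm
  have := key (e (a / α)) (e (b / β)) (e (c / γ)) (by
    rw [← map_mul, ← map_mul, ← map_one e, ← map_neg]
    congr 1
    field_simp
    linear_combination h + hl)
  rw [← map_one e, ← map_mul, ← map_add, ← map_neg] at this
  simp only [e.injective.eq_iff, div_eq_iff hα, div_eq_iff hβ, div_eq_iff hγ, one_mul,
    neg_one_mul] at this
  have hon : OnJoin a b α β ↔ 1 + a / α * (b / β) = a / α := by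
    unfold OnJoin
    field_simp
  simpa only [hon] using this

lemma not_of_three_vertices (h5 : Fintype.card K = 5) (h : TriangleConfig A B C 1 1 1 a b c)
    (hA : A.card = 1) (hB : B.card = 1) (hC : C.card = 1) : False := by
  classical
  have count : ∀ {A B C : Finset K} {a b c : Fin 5 → K}, TriangleConfig A B C 1 1 1 a b c →
      ∀ {α}, A = {α} → 2 ≤ ∑ i, (if a i = α then 1 else 0) ∧
        ∑ i, (if a i = -α then 1 else 0) ≤ 1 := by
    intro A B C a b c h α hA
    have α0 : α ≠ 0 := fun e => h.zeroA (by simp [hA, e])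
    rw [← Finset.card_filter, ← Finset.card_filter]
    constructor
    · simpa [hA] using h.vertA α α0
    · have h1 := congrArg (Multiset.count (-α)) (h.vertex_eq h5 le_rfl hA)
      have hn : -α ≠ α := fun e => two_ne_zero_of_card h5
        (mul_right_cancel₀ α0 (by linear_combination -e))
      have h2 : ({1, -1, 2, -2, α} : Multiset K) = (Finset.univ.erase 0 : Finset K).val + {α} := by
        rw [univ_erase_zero_val h5]; rfl
      rw [h2, Multiset.count_add, Multiset.count_eq_of_nodup (Finset.nodup _),
        Multiset.count_singleton, if_neg hn, Multiset.count_map] at h1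
      have h3 : (Multiset.filter (fun i => -α = a i) (Finset.univ : Finset (Fin 5)).val).card =
          (Finset.univ.filter fun i => a i = -α).card := by
        simp only [eq_comm (a := -α)]
        rfl
      rw [← h3, h1]
      split_ifs <;> simp
  obtain ⟨α, hα⟩ := Finset.card_eq_one.1 hA
  obtain ⟨β, hβ⟩ := Finset.card_eq_one.1 hB
  obtain ⟨γ, hγ⟩ := Finset.card_eq_one.1 hC
  have α0 : α ≠ 0 := fun e => h.zeroA (by simp [hα, e])
  have β0 : β ≠ 0 := fun e => h.zeroB (by simp [hβ, e])
  have γ0 : γ ≠ 0 := fun e => h.zeroC (by simp [hγ, e])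
  obtain ⟨a1, a2⟩ := count h hα
  obtain ⟨b1, b2⟩ := count h.rotate hβ
  obtain ⟨c1, c2⟩ := count h.rotate.rotate hγ
  obtain ⟨-, -, pa⟩ := h.sums_of_vertex h5 le_rfl hα
  obtain ⟨-, -, pb⟩ := h.rotate.sums_of_vertex h5 le_rfl hβ
  obtain ⟨-, -, pc⟩ := h.rotate.rotate.sums_of_vertex h5 le_rfl hγ
  -- Multiplying all five product relations shows that the three removed side points are collinear,
  -- so their line needs two new points.
  have hl : α * β * γ = 1 := by
    have : ∏ i, (a i * b i * c i) = -1 := by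
      rw [Finset.prod_congr rfl fun i _ => h.prod i]
      norm_num
    rw [Finset.prod_mul_distrib, Finset.prod_mul_distrib, pa, pb, pc] at this
    linear_combination -this
  have hj := h.join α β γ hl
  rw [if_pos (by simp [hα]), if_pos (by simp [hβ]), if_pos (by simp [hγ]),
    Finset.card_filter] at hj
  -- Summed, the left side is at least 6·2 + 3·6 = 30 and the right side at most 15 + 3·3 = 24.
  have hw := Finset.sum_le_sum fun i (_ : i ∈ Finset.univ) =>
    weight_le h5 α0 β0 γ0 (h.prod i) hl
  simp only [Finset.sum_add_distrib, ← Finset.mul_sum] at hw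
  simp only [Finset.sum_const, Finset.card_univ, Fintype.card_fin, smul_eq_mul] at hw
  omega

end CardFive

end TriangleConfig

/-! ### The plane of order four -/

section Order

open Configuration

lemma PG2.order_eq [Finite K] [DecidableEq K] [Finite (PG2 K)] :
    ProjectivePlane.order (PG2 K) (PG2 K) = Nat.card K := by
  have := Fintype.ofFinite (PG2 K)
  have h1 := ProjectivePlane.card_points (PG2 K) (PG2 K)
  have h2 := Projectivization.card_of_finrank K (Fin 3 → K) (n := 3) (by simp)
  rw [← Nat.card_eq_fintype_card, h2] at h1
  simp only [Finset.sum_range_succ, Finset.range_zero, Finset.sum_empty] at h1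
  nlinarith [sq_nonneg ((ProjectivePlane.order (PG2 K) (PG2 K) : ℤ) - Nat.card K),
    lt_trichotomy (ProjectivePlane.order (PG2 K) (PG2 K)) (Nat.card K)]

/-- The projective plane of order four has no double blocking set with eleven points. -/
theorem not_isDoubleBlockingSet_of_card_four [Finite K] (h4 : Nat.card K = 4) {B : Set (PG2 K)}
    (hB : IsDoubleBlockingSet B) (hc : B.ncard = 11) : False := by
  classical
  have hfin : Finite (PG2 K) := inferInstance
  have := Fintype.ofFinite (PG2 K)
  have ho := PG2.order_eq (K := K)
  rw [h4] at ho
  have hpts : Fintype.card (PG2 K) = 21 := by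
    rw [ProjectivePlane.card_points (PG2 K) (PG2 K), ho]; rfl
  set X : Finset (PG2 K) := Finset.univ.filter (· ∉ B) with hX
  have hXc : X.card = 10 := by
    have h1 := Finset.card_filter_add_card_filter_not (s := (Finset.univ : Finset (PG2 K))) (· ∈ B)
    have h2 : (Finset.univ.filter (· ∈ B)).card = 11 := by
      rw [← hc, ← Set.ncard_coe_finset]; simp
    rw [Finset.card_univ, hpts, h2] at h1
    have h3 : 11 + X.card = 21 := by rw [← h1]
    omega
  have hl : ∀ l : PG2 K, (X.filter (· ∈ l)).card ≤ 3 := by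
    intro l
    have h1 : ((Finset.univ : Finset (PG2 K)).filter (· ∈ l)).card = 5 := by
      have := ProjectivePlane.pointCount_eq (PG2 K) l
      rwa [ho, pointCount, Nat.card_eq_fintype_card, Fintype.card_subtype] at this
    have h2 := Finset.card_filter_add_card_filter_not
      (s := (Finset.univ : Finset (PG2 K)).filter (· ∈ l)) (· ∈ B)
    have h3 : 2 ≤ ((Finset.univ.filter (· ∈ l)).filter (· ∈ B)).card := by
      refine (hB l).trans (le_of_eq ?_)
      rw [← Set.ncard_coe_finset]
      congr 1
      ext P
      simp [PG2.line, ofField.mem_iff, and_comm]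
    have h4 : (Finset.univ.filter (· ∈ l)).filter (· ∉ B) = X.filter (· ∈ l) := by
      ext P; simp [hX, and_comm]
    have h5 : ((Finset.univ.filter (· ∈ l)).filter (· ∈ B)).card + (X.filter (· ∈ l)).card = 5 := by
      rw [← h4, ← h1]; exact h2
    omega
  -- The five lines through P meet the 10-point complement in 5 + 9 = 14 incidences, with at most
  -- three on each, so exactly four lines carry three.
  have hp : ∀ P ∈ X, (Finset.univ.filter
      fun l : PG2 K => P ∈ l ∧ (X.filter (· ∈ l)).card = 3).card = 4 := by
    intro P hP
    set S := (Finset.univ : Finset (PG2 K)).filter (P ∈ ·) with hS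
    have h1 : S.card = 5 := by
      have := ProjectivePlane.lineCount_eq (PG2 K) P
      rwa [ho, lineCount, Nat.card_eq_fintype_card, Fintype.card_subtype] at this
    have h2 : ∑ l ∈ S, (X.filter (· ∈ l)).card = 14 := by
      have h3 : ∑ Q ∈ X, (S.filter (Q ∈ ·)).card = ∑ l ∈ S, (X.filter (· ∈ l)).card :=
        Finset.sum_card_bipartiteAbove_eq_sum_card_bipartiteBelow (fun Q l => Q ∈ l)
      rw [← h3, ← Finset.add_sum_erase _ _ hP]
      have h4 : ∀ Q ∈ X.erase P, (S.filter (Q ∈ ·)).card = 1 := by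
        intro Q hQ
        obtain ⟨l, hl1, hl2⟩ := HasLines.existsUnique_line (PG2 K) (PG2 K) P Q
          (Finset.ne_of_mem_erase hQ).symm
        rw [Finset.card_eq_one]
        refine ⟨l, Finset.ext fun m => ?_⟩
        simp only [hS, Finset.mem_filter, Finset.mem_univ, true_and, Finset.mem_singleton]
        exact ⟨fun hm => hl2 m hm, fun hm => hm ▸ hl1⟩
      have h5 : S.filter (P ∈ ·) = S := by rw [hS, Finset.filter_filter]; simp
      rw [Finset.sum_congr rfl h4, h5, h1, Finset.sum_const, Finset.card_erase_of_mem hP, hXc]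
      rfl
    have h3 : (S.filter (fun l => (X.filter (· ∈ l)).card = 3)).card +
        (S.filter (fun l => ¬ (X.filter (· ∈ l)).card = 3)).card = S.card :=
      Finset.card_filter_add_card_filter_not _
    have h4 : ∑ l ∈ S.filter (fun l => (X.filter (· ∈ l)).card = 3), (X.filter (· ∈ l)).card +
        ∑ l ∈ S.filter (fun l => ¬ (X.filter (· ∈ l)).card = 3), (X.filter (· ∈ l)).card =
        ∑ l ∈ S, (X.filter (· ∈ l)).card :=
      Finset.sum_filter_add_sum_filter_not S _ _
    have h5 : ∑ l ∈ S.filter (fun l => (X.filter (· ∈ l)).card = 3), (X.filter (· ∈ l)).card =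
        (S.filter (fun l => (X.filter (· ∈ l)).card = 3)).card * 3 :=
      Finset.sum_const_nat fun l hl => (Finset.mem_filter.1 hl).2
    have h6 : ∑ l ∈ S.filter (fun l => ¬ (X.filter (· ∈ l)).card = 3), (X.filter (· ∈ l)).card ≤
        (S.filter (fun l => ¬ (X.filter (· ∈ l)).card = 3)).card * 2 := by
      refine Finset.sum_le_card_nsmul _ _ 2 fun l hm => ?_
      have h7 := (Finset.mem_filter.1 hm).2
      have h8 := hl l
      exact Nat.le_of_lt_succ (lt_of_le_of_ne h8 h7)
    have h7 : (Finset.univ.filter fun l : PG2 K => P ∈ l ∧ (X.filter (· ∈ l)).card = 3) =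
        S.filter (fun l => (X.filter (· ∈ l)).card = 3) := by
      rw [hS, Finset.filter_filter]
    rw [h7]
    omega
  have h1 : ∑ P ∈ X, ((Finset.univ.filter
      fun l : PG2 K => (X.filter (· ∈ l)).card = 3).filter (P ∈ ·)).card =
      ∑ l ∈ Finset.univ.filter fun l : PG2 K => (X.filter (· ∈ l)).card = 3,
        (X.filter (· ∈ l)).card :=
    Finset.sum_card_bipartiteAbove_eq_sum_card_bipartiteBelow (fun Q l => Q ∈ l)
  -- Counting incidences with these lines equates 10·4 with a multiple of 3.
  rw [Finset.sum_const_nat (m := 4), Finset.sum_const_nat (m := 3), hXc] at h1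
  · omega
  · exact fun l hl => (Finset.mem_filter.1 hl).2
  · intro P hP
    rw [← hp P hP, Finset.filter_filter]
    simp only [and_comm]

end Order

/-! ### From geometry to configurations -/

lemma ncard_add_card_le {α ι : Type*} [Fintype ι] (P : ι → α) {S R : Set α}
    (hS : ∀ x ∈ S, ∃ i, x = P i) (hR : Disjoint S R) [DecidablePred (· ∈ R)] :
    S.ncard + (Finset.univ.filter fun i => P i ∈ R).card ≤ Fintype.card ι := by
  classical
  have h1 : S ⊆ P '' (Finset.univ.filter fun i => P i ∉ R) := by
    intro x hx
    obtain ⟨i, rfl⟩ := hS x hx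
    exact ⟨i, by simpa using Set.disjoint_left.1 hR hx, rfl⟩
  have h2 := (Set.ncard_le_ncard h1 (Set.toFinite _)).trans (Set.ncard_image_le (Set.toFinite _))
  rw [Set.ncard_coe_finset] at h2
  have h3 := Finset.card_filter_add_card_filter_not (s := (Finset.univ : Finset ι)) (P · ∈ R)
  rw [Finset.card_univ] at h3
  omega

open Matrix in
lemma orthogonal_iff (P l : PG2 K) : Projectivization.orthogonal P l ↔ l.rep ⬝ᵥ P.rep = 0 := by
  conv_lhs => rw [← P.mk_rep, ← l.mk_rep, Projectivization.orthogonal_mk]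
  rw [dotProduct_comm]

open Matrix in
/-- Homogeneous coordinates in which a given triangle is the coordinate triangle. -/
lemma exists_coordinates {l m n : PG2 K} (h : PG2.line l ∩ PG2.line m ∩ PG2.line n = ∅) :
    ∃ (X : PG2 K → Fin 3 → K) (pt : (Fin 3 → K) → PG2 K),
      (∀ P, P ∈ PG2.line l ∪ PG2.line m ∪ PG2.line n ↔ X P 0 = 0 ∨ X P 1 = 0 ∨ X P 2 = 0) ∧
      (∀ w ≠ 0, ∃ L, ∀ P, P ∈ PG2.line L ↔ w ⬝ᵥ X P = 0) ∧
      (∀ P u (t : K), X P = t • u → P = pt u) := by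
  set M : Matrix (Fin 3) (Fin 3) K := .of ![l.rep, m.rep, n.rep] with hM
  have hX : ∀ v, M *ᵥ v = ![l.rep ⬝ᵥ v, m.rep ⬝ᵥ v, n.rep ⬝ᵥ v] := by
    intro v; ext i; fin_cases i <;> rfl
  have hinj : Function.Injective M.mulVec := by
    rw [← Matrix.coe_mulVecLin, ← LinearMap.ker_eq_bot, LinearMap.ker_eq_bot']
    intro v hv
    by_contra hv0
    have hv : M *ᵥ v = 0 := hv
    rw [hX] at hv
    have : Projectivization.mk K v hv0 ∈ PG2.line l ∩ PG2.line m ∩ PG2.line n := by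
      have e : ∀ k : PG2 K, k.rep ⬝ᵥ v = 0 → Projectivization.mk K v hv0 ∈ PG2.line k := by
        intro k hk
        change Projectivization.orthogonal (Projectivization.mk K v hv0) k
        rw [← k.mk_rep, Projectivization.orthogonal_mk, dotProduct_comm, hk]
      exact ⟨⟨e l (congrFun hv 0), e m (congrFun hv 1)⟩, e n (congrFun hv 2)⟩
    rw [h] at this
    exact this
  have hu := mulVec_injective_iff_isUnit.1 hinj
  have hne : ∀ P : PG2 K, M *ᵥ P.rep ≠ 0 := fun P e =>
    P.rep_nonzero (hinj (by rw [e, mulVec_zero]))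
  have huniq : ∀ (P Q : PG2 K) (u : Fin 3 → K) (s t : K), M *ᵥ P.rep = s • u → M *ᵥ Q.rep = t • u → P = Q := by
    intro P Q u s t h1 h2
    have ht : t ≠ 0 := fun e => hne Q (by rw [h2, e, zero_smul])
    rw [← P.mk_rep, ← Q.mk_rep, Projectivization.mk_eq_mk_iff']
    refine ⟨s / t, hinj ?_⟩
    rw [mulVec_smul, h1, h2, smul_smul, div_mul_cancel₀ _ ht]
  classical
  refine ⟨fun P => M *ᵥ P.rep,
    -- The default `l` is immaterial: `pt` is only evaluated through the last property, where a
    -- preimage exists.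
    fun u => if hu : ∃ P : PG2 K, ∃ t : K, M *ᵥ P.rep = t • u then hu.choose else l,
    ?_, ?_, ?_⟩
  · intro P
    beta_reduce
    rw [hX]
    simp only [PG2.line, Set.mem_union, Set.mem_ofPred_eq, orthogonal_iff]
    rw [or_assoc]
    rfl
  · intro w hw
    have hw' : w ᵥ* M ≠ 0 := by
      intro e
      exact hw (vecMul_injective_iff_isUnit.2 hu (e.trans (zero_vecMul M).symm))
    refine ⟨Projectivization.mk K _ hw', fun P => ?_⟩
    change Projectivization.orthogonal P _ ↔ _
    conv_lhs => rw [← P.mk_rep, Projectivization.orthogonal_mk, dotProduct_comm,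
      ← dotProduct_mulVec]
  · intro P u t hP
    have he : ∃ P : PG2 K, ∃ t : K, M *ᵥ P.rep = t • u := ⟨P, t, hP⟩
    beta_reduce
    rw [dif_pos he]
    obtain ⟨s, hs⟩ := he.choose_spec
    exact huniq _ _ u t s hP hs

-- The indexed points need only contain the triangle points on L. Repetitions or superfluous points
-- only weaken the bound, so P need not be injective.
open Classical in
theorem two_add_card_le_of_isDoubleBlockingSet [Finite K] {ι : Type*} [Fintype ι]
    {T R : Set (PG2 K)} {f : Fin 5 → PG2 K} (hB : IsDoubleBlockingSet ((T \ R) ∪ Set.range f))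
    {L : PG2 K} {s : Finset (Fin 5)} (hs : ∀ i, f i ∈ PG2.line L → i ∈ s) (P : ι → PG2 K)
    (hP : ∀ Q ∈ T, Q ∈ PG2.line L → ∃ i, Q = P i) :
    2 + (Finset.univ.filter fun i => P i ∈ R).card ≤ Fintype.card ι + s.card := by
  have hfin : Finite (PG2 K) := inferInstance
  have h1 := hB L
  rw [Set.union_inter_distrib_right] at h1
  have h2 := Set.ncard_union_le ((T \ R) ∩ PG2.line L) (Set.range f ∩ PG2.line L)
  have h3 : Set.range f ∩ PG2.line L ⊆ f '' s := by
    rintro _ ⟨⟨i, rfl⟩, hQL⟩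
    exact ⟨i, hs i hQL, rfl⟩
  have h4 := (Set.ncard_le_ncard h3 (Set.toFinite _)).trans (Set.ncard_image_le (Set.toFinite _))
  rw [Set.ncard_coe_finset] at h4
  have h5 := ncard_add_card_le P (S := (T \ R) ∩ PG2.line L) (R := R)
    (fun Q hQ => hP Q hQ.1.1 hQ.2) (Set.disjoint_left.2 fun Q hQ => hQ.1.2)
  omega

-- The vertex and join inequalities come from lines meeting the triangle in two and three points.
-- The last three bounds come from the sides: they contain no new points, so two of their q + 1
-- points must survive.
open Matrix in
open Classical in
theorem exists_triangleConfig [Finite K] {B T : Set (PG2 K)} (hB : IsDoubleBlockingSet B)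
    (hT : IsTriangle T) (hO : IsObtainedBy 6 5 T B) :
    ∃ (A₀ A₁ A₂ : Finset K) (u₀ u₁ u₂ : ℕ) (a b c : Fin 5 → K),
      TriangleConfig A₀ A₁ A₂ u₀ u₁ u₂ a b c ∧ u₀ ≤ 1 ∧ u₁ ≤ 1 ∧ u₂ ≤ 1 ∧
      A₀.card + u₁ + u₂ + 1 ≤ Nat.card K ∧ A₁.card + u₂ + u₀ + 1 ≤ Nat.card K ∧
      A₂.card + u₀ + u₁ + 1 ≤ Nat.card K := by
  have := Fintype.ofFinite K
  have hfin : Finite (PG2 K) := inferInstance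
  obtain ⟨l, m, n, hlmn, rfl⟩ := hT
  obtain ⟨R, N, hR, hRc, hN, hNc, rfl⟩ := hO
  obtain ⟨X, pt, hXT, hXl, hpt⟩ := exists_coordinates hlmn
  set T := PG2.line l ∪ PG2.line m ∪ PG2.line n
  have hpt1 : ∀ P, P = pt (X P) := fun P => hpt P _ 1 (one_smul _ _).symm
  obtain ⟨f, hf, hfN⟩ : ∃ f : Fin 5 → PG2 K, Function.Injective f ∧ Set.range f = N := by
    have : Nat.card N = 5 := hNc
    let e := Finite.equivFinOfCardEq this
    exact ⟨fun i => (e.symm i).1, Subtype.val_injective.comp e.symm.injective, by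
      ext P
      constructor
      · rintro ⟨i, rfl⟩; exact (e.symm i).2
      · intro hP; exact ⟨e ⟨P, hP⟩, by simp⟩⟩
  have hf0 : ∀ i, X (f i) 0 ≠ 0 ∧ X (f i) 1 ≠ 0 ∧ X (f i) 2 ≠ 0 := by
    intro i
    have h1 : f i ∉ T := Set.disjoint_left.1 hN (hfN ▸ Set.mem_range_self i)
    rw [hXT] at h1
    tauto
  have hline : ∀ (w : Fin 3 → K), w ≠ 0 → ∀ {ι : Type} [Fintype ι] (P : ι → PG2 K),
      (∀ Q, w ⬝ᵥ X Q = 0 → (X Q 0 = 0 ∨ X Q 1 = 0 ∨ X Q 2 = 0) → ∃ i, Q = P i) →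
      2 + (Finset.univ.filter fun i => P i ∈ R).card ≤
        Fintype.card ι + (Finset.univ.filter fun i => w ⬝ᵥ X (f i) = 0).card := by
    intro w hw ι _ P hP
    obtain ⟨L, hL⟩ := hXl w hw
    exact two_add_card_le_of_isDoubleBlockingSet (hfN ▸ hB) (L := L)
      (fun i hi => by simpa using (hL _).1 hi) P
      (fun Q hQ hQL => hP Q ((hL Q).1 hQL) ((hXT Q).1 hQ))
  set A₀ : Finset K := Finset.univ.filter fun α => α ≠ 0 ∧ pt ![0, 1, -α] ∈ R with hA₀
  set A₁ : Finset K := Finset.univ.filter fun α => α ≠ 0 ∧ pt ![-α, 0, 1] ∈ R with hA₁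
  set A₂ : Finset K := Finset.univ.filter fun α => α ≠ 0 ∧ pt ![1, -α, 0] ∈ R with hA₂
  have mA₀ : ∀ α, α ≠ 0 → (pt ![0, 1, -α] ∈ R ↔ α ∈ A₀) := fun α h => by simp [hA₀, h]
  have mA₁ : ∀ α, α ≠ 0 → (pt ![-α, 0, 1] ∈ R ↔ α ∈ A₁) := fun α h => by simp [hA₁, h]
  have mA₂ : ∀ α, α ≠ 0 → (pt ![1, -α, 0] ∈ R ↔ α ∈ A₂) := fun α h => by simp [hA₂, h]
  set u₀ : ℕ := if pt ![1, 0, 0] ∈ R then 1 else 0 with hu₀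
  set u₁ : ℕ := if pt ![0, 1, 0] ∈ R then 1 else 0 with hu₁
  set u₂ : ℕ := if pt ![0, 0, 1] ∈ R then 1 else 0 with hu₂
  have e₀ : ∀ Q, X Q 1 = 0 → X Q 2 = 0 → Q = pt ![1, 0, 0] := fun Q h1 h2 =>
    hpt Q _ (X Q 0) (by ext i; fin_cases i <;> simp [h1, h2])
  have e₁ : ∀ Q, X Q 2 = 0 → X Q 0 = 0 → Q = pt ![0, 1, 0] := fun Q h1 h2 =>
    hpt Q _ (X Q 1) (by ext i; fin_cases i <;> simp [h1, h2])
  have e₂ : ∀ Q, X Q 0 = 0 → X Q 1 = 0 → Q = pt ![0, 0, 1] := fun Q h1 h2 =>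
    hpt Q _ (X Q 2) (by ext i; fin_cases i <;> simp [h1, h2])
  have s₀ : ∀ Q α, X Q 0 = 0 → X Q 2 = -α * X Q 1 → Q = pt ![0, 1, -α] := fun Q α h1 h2 =>
    hpt Q _ (X Q 1) (by ext i; fin_cases i <;> simp [h1, h2, mul_comm])
  have s₁ : ∀ Q α, X Q 1 = 0 → X Q 0 = -α * X Q 2 → Q = pt ![-α, 0, 1] := fun Q α h1 h2 =>
    hpt Q _ (X Q 2) (by ext i; fin_cases i <;> simp [h1, h2, mul_comm])
  have s₂ : ∀ Q α, X Q 2 = 0 → X Q 1 = -α * X Q 0 → Q = pt ![1, -α, 0] := fun Q α h1 h2 =>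
    hpt Q _ (X Q 0) (by ext i; fin_cases i <;> simp [h1, h2, mul_comm])
  have two : ∀ P Q : PG2 K, (Finset.univ.filter fun i => ![P, Q] i ∈ R).card =
      (if P ∈ R then 1 else 0) + (if Q ∈ R then 1 else 0) := by
    intro P Q
    rw [Finset.card_filter, Fin.sum_univ_two]
    rfl
  have three : ∀ P Q S : PG2 K, (Finset.univ.filter fun i => ![P, Q, S] i ∈ R).card =
      (if P ∈ R then 1 else 0) + (if Q ∈ R then 1 else 0) + (if S ∈ R then 1 else 0) := by
    intro P Q S
    rw [Finset.card_filter, Fin.sum_univ_three]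
    rfl
  have dot : ∀ x y z Q, ![x, y, z] ⬝ᵥ X Q = x * X Q 0 + y * X Q 1 + z * X Q 2 := by
    intro x y z Q
    simp [dotProduct, Fin.sum_univ_three]
  have side : ∀ (w : Fin 3 → K), w ≠ 0 → (∀ i, w ⬝ᵥ X (f i) ≠ 0) → ∀ (P Q : PG2 K)
      (E : K → PG2 K), (∀ S, w ⬝ᵥ X S = 0 → (X S 0 = 0 ∨ X S 1 = 0 ∨ X S 2 = 0) →
        S = P ∨ S = Q ∨ ∃ α, α ≠ 0 ∧ S = E α) →
      (Finset.univ.filter fun α => α ≠ 0 ∧ E α ∈ R).card + (if P ∈ R then 1 else 0) +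
        (if Q ∈ R then 1 else 0) + 1 ≤ Nat.card K := by
    intro w hw hw' P Q E hE
    obtain ⟨L, hL⟩ := hXl w hw
    have h1 := two_add_card_le_of_isDoubleBlockingSet (ι := Fin 2 ⊕ {α : K // α ≠ 0}) (s := ∅)
      (hfN ▸ hB) (L := L) (fun i hi => absurd ((hL _).1 hi) (hw' i))
      (Sum.elim ![P, Q] fun α => E α.1) (by
        intro S h1 h2
        rcases hE S ((hL S).1 h2) ((hXT S).1 h1) with rfl | rfl | ⟨α, hα, rfl⟩
        · exact ⟨Sum.inl 0, rfl⟩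
        · exact ⟨Sum.inl 1, rfl⟩
        · exact ⟨Sum.inr ⟨α, hα⟩, rfl⟩)
    have hcard : Fintype.card {α : K // α ≠ 0} = Fintype.card K - 1 := by
      rw [Fintype.card_subtype_compl, Fintype.card_subtype_eq]
    rw [Finset.card_empty, Finset.card_filter, Fintype.sum_sum_type, Fin.sum_univ_two,
      Fintype.card_sum, Fintype.card_fin, hcard] at h1
    have h2 : (Finset.univ.filter fun α => α ≠ 0 ∧ E α ∈ R).card =
        ∑ α : {α : K // α ≠ 0}, if E α.1 ∈ R then 1 else 0 := by
      rw [← Finset.filter_filter, Finset.card_filter]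
      exact (Finset.sum_subtype _ (by simp) (fun α => if E α ∈ R then 1 else 0))
    replace h1 : 2 + ((if P ∈ R then 1 else 0) + (if Q ∈ R then 1 else 0) +
        ∑ α : {α : K // α ≠ 0}, if E α.1 ∈ R then 1 else 0) ≤
          2 + (Fintype.card K - 1) + 0 := h1
    have h3 : 0 < Fintype.card K := Fintype.card_pos
    rw [h2, Nat.card_eq_fintype_card]
    omega
  refine ⟨A₀, A₁, A₂, u₀, u₁, u₂, fun i => -X (f i) 2 / X (f i) 1, fun i => -X (f i) 0 / X (f i) 2,
    fun i => -X (f i) 1 / X (f i) 0, ?_, ?_, ?_, ?_, ?_, ?_, ?_⟩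
  · constructor
    · intro i
      obtain ⟨h0, h1, h2⟩ := hf0 i
      field_simp
    · intro i j hi hj
      obtain ⟨h0, h1, h2⟩ := hf0 i
      obtain ⟨h0', h1', h2'⟩ := hf0 j
      apply hf
      rw [hpt1 (f j)]
      refine hpt _ _ (X (f i) 2 / X (f j) 2) ?_
      field_simp at hi hj
      ext k
      fin_cases k
      · simp; field_simp; linear_combination -hj
      · simp; field_simp; linear_combination hi
      · simp; field_simp
    · simp [hA₀]
    · simp [hA₁]
    · simp [hA₂]
    · intro α hα
      have h1 := hline ![0, α, 1] (fun e => one_ne_zero (congrFun e 2))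
        ![pt ![0, 1, -α], pt ![1, 0, 0]] (by
        intro Q h1 h2
        rw [dot] at h1
        by_cases h3 : X Q 0 = 0
        · exact ⟨0, s₀ Q α h3 (by linear_combination h1)⟩
        · refine ⟨1, ?_⟩
          rcases h2 with h2 | h2 | h2
          · exact absurd h2 h3
          · exact e₀ Q h2 (by linear_combination h1 - α * h2)
          · exact e₀ Q (mul_left_cancel₀ hα (by linear_combination h1 - h2)) h2)
      rw [two, Fintype.card_fin] at h1
      simp only [mA₀ α hα] at h1
      have h2 : (Finset.univ.filter fun i => ![0, α, 1] ⬝ᵥ X (f i) = 0) =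
          Finset.univ.filter fun i => -X (f i) 2 / X (f i) 1 = α := by
        refine Finset.filter_congr fun i _ => ?_
        obtain ⟨h0, h1, h2⟩ := hf0 i
        rw [dot, div_eq_iff h1]
        constructor <;> intro h <;> linear_combination -h
      rw [h2] at h1
      omega
    · intro α hα
      have h1 := hline ![1, 0, α] (fun e => one_ne_zero (congrFun e 0))
        ![pt ![-α, 0, 1], pt ![0, 1, 0]] (by
        intro Q h1 h2
        rw [dot] at h1
        by_cases h3 : X Q 1 = 0
        · exact ⟨0, s₁ Q α h3 (by linear_combination h1)⟩
        · refine ⟨1, ?_⟩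
          rcases h2 with h2 | h2 | h2
          · exact e₁ Q (mul_left_cancel₀ hα (by linear_combination h1 - h2)) h2
          · exact absurd h2 h3
          · exact e₁ Q h2 (by linear_combination h1 - α * h2))
      rw [two, Fintype.card_fin] at h1
      simp only [mA₁ α hα] at h1
      have h2 : (Finset.univ.filter fun i => ![1, 0, α] ⬝ᵥ X (f i) = 0) =
          Finset.univ.filter fun i => -X (f i) 0 / X (f i) 2 = α := by
        refine Finset.filter_congr fun i _ => ?_
        obtain ⟨h0, h1, h2⟩ := hf0 i
        rw [dot, div_eq_iff h2]
        constructor <;> intro h <;> linear_combination -h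
      rw [h2] at h1
      omega
    · intro α hα
      have h1 := hline ![α, 1, 0] (fun e => one_ne_zero (congrFun e 1))
        ![pt ![1, -α, 0], pt ![0, 0, 1]] (by
        intro Q h1 h2
        rw [dot] at h1
        by_cases h3 : X Q 2 = 0
        · exact ⟨0, s₂ Q α h3 (by linear_combination h1)⟩
        · refine ⟨1, ?_⟩
          rcases h2 with h2 | h2 | h2
          · exact e₂ Q h2 (by linear_combination h1 - α * h2)
          · exact e₂ Q (mul_left_cancel₀ hα (by linear_combination h1 - h2)) h2
          · exact absurd h2 h3)
      rw [two, Fintype.card_fin] at h1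
      simp only [mA₂ α hα] at h1
      have h2 : (Finset.univ.filter fun i => ![α, 1, 0] ⬝ᵥ X (f i) = 0) =
          Finset.univ.filter fun i => -X (f i) 1 / X (f i) 0 = α := by
        refine Finset.filter_congr fun i _ => ?_
        obtain ⟨h0, h1, h2⟩ := hf0 i
        rw [dot, div_eq_iff h0]
        constructor <;> intro h <;> linear_combination -h
      rw [h2] at h1
      omega
    · intro α β γ hl
      have hα : α ≠ 0 := by rintro rfl; simp at hl
      have hβ : β ≠ 0 := by rintro rfl; simp at hl
      have hγ : γ ≠ 0 := by rintro rfl; simp at hl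
      -- This is the line through the points with parameters α and γ; αβγ = 1 puts the point with
      -- parameter β on it.
      have h1 := hline ![α * γ, α, 1] (fun e => one_ne_zero (congrFun e 2))
        ![pt ![0, 1, -α], pt ![-β, 0, 1], pt ![1, -γ, 0]] (by
        intro Q h1 h2
        rw [dot] at h1
        rcases h2 with h2 | h2 | h2
        · exact ⟨0, s₀ Q α h2 (by linear_combination h1 - α * γ * h2)⟩
        · exact ⟨1, s₁ Q β h2 (by linear_combination β * h1 - X Q 0 * hl - α * β * h2)⟩
        · exact ⟨2, s₂ Q γ h2 (mul_left_cancel₀ hα (by linear_combination h1 - h2))⟩)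
      rw [three, Fintype.card_fin] at h1
      simp only [mA₀ α hα, mA₁ β hβ, mA₂ γ hγ] at h1
      have h2 : (Finset.univ.filter fun i => ![α * γ, α, 1] ⬝ᵥ X (f i) = 0) =
          Finset.univ.filter fun i =>
            OnJoin (-X (f i) 2 / X (f i) 1) (-X (f i) 0 / X (f i) 2) α β := by
        refine Finset.filter_congr fun i _ => ?_
        obtain ⟨h0, h1, h2⟩ := hf0 i
        rw [dot]
        unfold OnJoin
        constructor
        · intro h
          field_simp
          linear_combination β * h - X (f i) 0 * hl
        · intro h
          field_simp at h
          linear_combination α * γ * h - (α * X (f i) 1 + X (f i) 2) * hl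
      rw [h2] at h1
      omega
    · have h1 : R ⊆ ((fun α => pt ![0, 1, -α]) '' A₀ ∪ (fun α => pt ![-α, 0, 1]) '' A₁) ∪
          (fun α => pt ![1, -α, 0]) '' A₂ ∪ (if pt ![1, 0, 0] ∈ R then {pt ![1, 0, 0]} else ∅) ∪
          (if pt ![0, 1, 0] ∈ R then {pt ![0, 1, 0]} else ∅) ∪
          (if pt ![0, 0, 1] ∈ R then {pt ![0, 0, 1]} else ∅) := by
        intro Q hQ
        have hV₀ : Q = pt ![1, 0, 0] → Q ∈ (if pt ![1, 0, 0] ∈ R then {pt ![1, 0, 0]} else ∅ :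
          Set (PG2 K)) := by rintro rfl; simp [hQ]
        have hV₁ : Q = pt ![0, 1, 0] → Q ∈ (if pt ![0, 1, 0] ∈ R then {pt ![0, 1, 0]} else ∅ :
          Set (PG2 K)) := by rintro rfl; simp [hQ]
        have hV₂ : Q = pt ![0, 0, 1] → Q ∈ (if pt ![0, 0, 1] ∈ R then {pt ![0, 0, 1]} else ∅ :
          Set (PG2 K)) := by rintro rfl; simp [hQ]
        simp only [Set.mem_union]
        by_cases h0 : X Q 0 = 0
        · by_cases h1 : X Q 1 = 0
          · exact Or.inr (hV₂ (e₂ Q h0 h1))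
          by_cases h2 : X Q 2 = 0
          · exact Or.inl (Or.inr (hV₁ (e₁ Q h2 h0)))
          have e := s₀ Q (-X Q 2 / X Q 1) h0 (by field_simp)
          refine Or.inl (Or.inl (Or.inl (Or.inl (Or.inl ⟨_, ?_, e.symm⟩))))
          exact (mA₀ _ (by simp [h1, h2])).1 (e ▸ hQ)
        by_cases h1 : X Q 1 = 0
        · by_cases h2 : X Q 2 = 0
          · exact Or.inl (Or.inl (Or.inr (hV₀ (e₀ Q h1 h2))))
          have e := s₁ Q (-X Q 0 / X Q 2) h1 (by field_simp)
          refine Or.inl (Or.inl (Or.inl (Or.inl (Or.inr ⟨_, ?_, e.symm⟩))))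
          exact (mA₁ _ (by simp [h0, h2])).1 (e ▸ hQ)
        have h2 : X Q 2 = 0 := by
          have := (hXT Q).1 (hR hQ)
          tauto
        have e := s₂ Q (-X Q 1 / X Q 0) h2 (by field_simp)
        refine Or.inl (Or.inl (Or.inl (Or.inr ⟨_, ?_, e.symm⟩)))
        exact (mA₂ _ (by simp [h0, h1])).1 (e ▸ hQ)
      have hV : ∀ P : PG2 K, (if P ∈ R then {P} else ∅ : Set (PG2 K)).ncard =
          if P ∈ R then 1 else 0 := by
        intro P; split_ifs <;> simp
      have hI : ∀ (s : Finset K) (g : K → PG2 K), (g '' s).ncard ≤ s.card := by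
        intro s g
        simpa using Set.ncard_image_le (f := g) s.finite_toSet
      rw [← hRc, hu₀, hu₁, hu₂, ← hV, ← hV, ← hV]
      refine (Set.ncard_le_ncard h1 (Set.toFinite _)).trans ?_
      refine (Set.ncard_union_le _ _).trans (Nat.add_le_add_right ?_ _)
      refine (Set.ncard_union_le _ _).trans (Nat.add_le_add_right ?_ _)
      refine (Set.ncard_union_le _ _).trans (Nat.add_le_add_right ?_ _)
      refine (Set.ncard_union_le _ _).trans (Nat.add_le_add ?_ (hI _ _))
      exact (Set.ncard_union_le _ _).trans (Nat.add_le_add (hI _ _) (hI _ _))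
  · rw [hu₀]; split_ifs <;> simp
  · rw [hu₁]; split_ifs <;> simp
  · rw [hu₂]; split_ifs <;> simp
  · refine side ![1, 0, 0] (fun e => one_ne_zero (congrFun e 0)) (fun i => ?_) _ _ _ fun S h1 h2 => ?_
    · rw [dot]; simpa using (hf0 i).1
    · rw [dot] at h1
      simp only [one_mul, zero_mul, add_zero] at h1
      by_cases h3 : X S 1 = 0
      · exact Or.inr (Or.inl (e₂ S h1 h3))
      by_cases h4 : X S 2 = 0
      · exact Or.inl (e₁ S h4 h1)
      · exact Or.inr (Or.inr ⟨-X S 2 / X S 1, by simp [h3, h4], s₀ S _ h1 (by field_simp)⟩)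
  · refine side ![0, 1, 0] (fun e => one_ne_zero (congrFun e 1)) (fun i => ?_) _ _ _ fun S h1 h2 => ?_
    · rw [dot]; simpa using (hf0 i).2.1
    · rw [dot] at h1
      simp only [one_mul, zero_mul, add_zero, zero_add] at h1
      by_cases h3 : X S 2 = 0
      · exact Or.inr (Or.inl (e₀ S h1 h3))
      by_cases h4 : X S 0 = 0
      · exact Or.inl (e₂ S h4 h1)
      · exact Or.inr (Or.inr ⟨-X S 0 / X S 2, by simp [h3, h4], s₁ S _ h1 (by field_simp)⟩)
  · refine side ![0, 0, 1] (fun e => one_ne_zero (congrFun e 2)) (fun i => ?_) _ _ _ fun S h1 h2 => ?_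
    · rw [dot]; simpa using (hf0 i).2.2
    · rw [dot] at h1
      simp only [one_mul, zero_mul, zero_add] at h1
      by_cases h3 : X S 0 = 0
      · exact Or.inr (Or.inl (e₁ S h1 h3))
      by_cases h4 : X S 1 = 0
      · exact Or.inl (e₀ S h4 h1)
      · exact Or.inr (Or.inr ⟨-X S 1 / X S 0, by simp [h3, h4], s₂ S _ h1 (by field_simp)⟩)

/-! ### Numerical case analysis for removed vertices -/

namespace TriangleConfig

variable {A B C : Finset K} {u v w : ℕ} {a b c : Fin 5 → K}

lemma not_of_card_five [Fintype K] (h5 : Fintype.card K = 5)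
    (h : TriangleConfig A B C u v w a b c) (hu : u ≤ 1) (hv : v ≤ 1) (hw : w = 1)
    (hA : A.card + v + w ≤ 4) (hB : B.card + w + u ≤ 4) (hC : C.card + u + v ≤ 4) : False := by
  subst hw
  have ht := h.total
  have hCw := h.rotate.rotate.card_le_of_vertex le_rfl
  rcases Nat.le_one_iff_eq_zero_or_eq_one.1 hu with rfl | rfl <;>
    rcases Nat.le_one_iff_eq_zero_or_eq_one.1 hv with rfl | rfl
  · have hAB := h.card_add_card_le
    -- A removed point on the side opposite the vertex would limit |A| + |B| to 3; as |C| ≤ 1, the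
    -- total would be at most five.
    have hC0 : C.card = 0 := by
      by_contra hne
      obtain ⟨γ, hγ⟩ := Finset.card_pos.1 (Nat.pos_of_ne_zero hne)
      have := h.rotate.rotate.card_le_of_mem hγ
      omega
    exact h.not_of_one_vertex h5 le_rfl (by omega)
  · have hBv := h.rotate.card_le_of_vertex le_rfl
    exact h.rotate.not_of_two_vertices h5 (by omega) (by omega) (by omega)
  · have hAu := h.card_le_of_vertex le_rfl
    exact h.rotate.rotate.not_of_two_vertices h5 (by omega) (by omega) (by omega)
  · have hAu := h.card_le_of_vertex le_rfl
    have hBv := h.rotate.card_le_of_vertex le_rfl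
    by_cases e : A.card = 1 ∧ B.card = 1 ∧ C.card = 1
    · exact h.not_of_three_vertices h5 e.1 e.2.1 e.2.2
    · omega

lemma card_eq_four_or_five [Fintype K] (h : TriangleConfig A B C u v w a b c)
    (hw : 1 ≤ w) (hA : A.card + v + w + 1 ≤ Fintype.card K)
    (hB : B.card + w + u + 1 ≤ Fintype.card K) (hC : C.card + u + v + 1 ≤ Fintype.card K) :
    Fintype.card K = 4 ∨ Fintype.card K = 5 := by
  have ht := h.total
  have hCw := h.rotate.rotate.card_le_of_vertex hw
  have h6 : Fintype.card K ≠ 6 := by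
    intro h6
    have := FiniteField.isPrimePow_card K
    rw [h6] at this
    revert this
    rw [isPrimePow_nat_iff_bounded]
    decide
  omega

end TriangleConfig

end

theorem theorem1 {K : Type*} [Field K] [Finite K] (q : ℕ) (hq : Nat.card K = q) :
    ¬ ∃ B : Set (PG2 K), IsDoubleBlockingSet B ∧ B.ncard = 3 * q - 1 ∧
      ∃ T : Set (PG2 K), IsTriangle T ∧ IsObtainedBy 6 5 T B := by
  rintro ⟨B, hB, hBc, T, hT, hO⟩
  have := Fintype.ofFinite K
  obtain ⟨A₀, A₁, A₂, u₀, u₁, u₂, a, b, c, h, hu₀, hu₁, hu₂, h₀, h₁, h₂⟩ :=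
    exists_triangleConfig hB hT hO
  have key : ∀ {A₀ A₁ A₂ : Finset K} {u₀ u₁ u₂ : ℕ} {a b c : Fin 5 → K},
      TriangleConfig A₀ A₁ A₂ u₀ u₁ u₂ a b c → u₀ ≤ 1 → u₁ ≤ 1 → u₂ = 1 →
      A₀.card + u₁ + u₂ + 1 ≤ Nat.card K → A₁.card + u₂ + u₀ + 1 ≤ Nat.card K →
      A₂.card + u₀ + u₁ + 1 ≤ Nat.card K → False := by
    intro A₀ A₁ A₂ u₀ u₁ u₂ a b c h hu₀ hu₁ hu₂ h₀ h₁ h₂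
    rw [Nat.card_eq_fintype_card] at h₀ h₁ h₂
    rcases h.card_eq_four_or_five hu₂.ge h₀ h₁ h₂ with h4 | h5
    · rw [← Nat.card_eq_fintype_card] at h4
      exact not_isDoubleBlockingSet_of_card_four h4 hB (by omega)
    · exact h.not_of_card_five h5 hu₀ hu₁ hu₂ (by omega) (by omega) (by omega)
  by_cases e₂ : u₂ = 1
  · exact key h hu₀ hu₁ e₂ h₀ h₁ h₂
  by_cases e₁ : u₁ = 1
  · exact key h.rotate.rotate hu₂ hu₀ e₁ h₂ h₀ h₁
  by_cases e₀ : u₀ = 1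
  · exact key h.rotate hu₁ hu₂ e₀ h₁ h₂ h₀
  obtain rfl : u₀ = 0 := by omega
  obtain rfl : u₁ = 0 := by omega
  obtain rfl : u₂ = 0 := by omega
  exact h.not_of_no_vertex
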